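/- Let $0<\gamma<1$ and put $$b=\frac{\gamma}{1-\gamma},\qquad a=(1-\gamma)\gamma^{\frac{\gamma}{1-\gamma}},\qquad c=\frac b2+1,\qquad A=\sqrt{2\pi(b+1)}\,(ab)^{-\frac1{b+1}\left(\frac12-c\right)} .$$ Let $\theta_1,\theta_2,\dots$ be the coefficients $\theta_n=[z^{n-1}]\,G_\theta(z)$ of $G_\theta(z)=A(1-z)^{-c}\exp\{a(1-z)^{-b}\}$, $|z|<1$. For a permutation $\sigma$ of $\{1,\dots,n\}$ let $R_j(\sigma)$ be the number of cycles of length $j$ in $\sigma$ (fixed points are cycles of length $1$), let $L_1(\sigma)$ be the length of the cycle containing the index $1$, and let $$\mathbb P_n(\sigma)=\frac1{n!\,h_n}\prod_{j\ge1}\theta_j^{R_j(\sigma)},\qquad h_n=\frac1{n!}\sum_{\sigma\in\mathcal S_n}\prod_{j\ge1}\theta_j^{R_j(\sigma)} .$$ Then $\theta_j>0$ for all $j\ge1$, each $\mathbb P_n$ is a probability measure, and as $n\to\infty$ under $\mathbb P_n$: (a) $L_1/(\log n)^{1/\gamma}$ converges to the constant $(1-\gamma)^{-1/\gamma}$ in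 probability (that is, for every $\varepsilon>0$, $\mathbb P_n\bigl(|L_1/(\log n)^{1/\gamma}-(1-\gamma)^{-1/\gamma}|>\varepsilon\bigr)\to0$), and equivalently in distribution. (b) The joint distribution of $(R_1,R_2,\dots)$, as a random element of $\mathbb N^{\mathbb N}$ with the product topology, converges weakly to the law of a sequence of independent Poisson random variables with respective means $\theta_1,\frac{\theta_2}2,\frac{\theta_3}3,\dots$. -/

import Mathlib

open MeasureTheory ProbabilityTheory Filter Topology

namespace WeightedPerm

/-- The finite set of permutations of `n` elements carries the discrete σ-algebra. -/
instance instMeasurableSpacePerm (n : ℕ) : MeasurableSpace (Equiv.Perm (Fin n)) := ⊤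

/-- `R_j(σ)`: the number of cycles of length `j` in `σ`, fixed points being cycles of length `1`
(`Equiv.Perm.partition` is the full cycle type, fixed points included). -/
def cycleCount {n : ℕ} (σ : Equiv.Perm (Fin n)) (j : ℕ) : ℕ :=
  σ.partition.parts.count j

/-- `L_1(σ)`: the length of the cycle of `σ` that contains the first index (which is `0 : Fin n`),
i.e. the number of elements in that cycle. For `n = 0` there is no index, and the value is `0`. -/
noncomputable def firstCycleLength {n : ℕ} (σ : Equiv.Perm (Fin n)) : ℕ :=
  {i : Fin n | ∃ h : 0 < n, σ.SameCycle ⟨0, h⟩ i}.ncard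

/-- The weight `∏_j θ_j ^ R_j(σ)` of a permutation; `R_j(σ) = 0` for `j > n`. -/
def weight (θ : ℕ → ℝ) {n : ℕ} (σ : Equiv.Perm (Fin n)) : ℝ :=
  ∏ j ∈ Finset.Icc 1 n, θ j ^ cycleCount σ j

/-- The normalization `h_n = (1 / n!) ∑_σ ∏_j θ_j ^ R_j(σ)`. -/
noncomputable def h (θ : ℕ → ℝ) (n : ℕ) : ℝ :=
  (1 / (n.factorial : ℝ)) * ∑ σ : Equiv.Perm (Fin n), weight θ σ

/-- The law `P_n` on permutations of `n` elements:
`P_n(σ) = (1 / (n! h_n)) ∏_j θ_j ^ R_j(σ)`. -/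
noncomputable def law (θ : ℕ → ℝ) (n : ℕ) : Measure (Equiv.Perm (Fin n)) :=
  ∑ σ : Equiv.Perm (Fin n),
    ENNReal.ofReal (weight θ σ / ((n.factorial : ℝ) * h θ n)) • Measure.dirac σ

/-- `b = γ / (1 - γ)`. -/
noncomputable def constb (γ : ℝ) : ℝ := γ / (1 - γ)

/-- `a = (1 - γ) γ ^ (γ / (1 - γ))`. -/
noncomputable def consta (γ : ℝ) : ℝ := (1 - γ) * γ ^ (γ / (1 - γ))

/-- `c = b / 2 + 1`. -/
noncomputable def constc (γ : ℝ) : ℝ := constb γ / 2 + 1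

/-- `A = √(2π (b + 1)) (ab) ^ (-(1 / (b + 1)) (1 / 2 - c))`. -/
noncomputable def constA (γ : ℝ) : ℝ :=
  √(2 * Real.pi * (constb γ + 1)) *
    (consta γ * constb γ) ^ (-(1 / (constb γ + 1)) * (1 / 2 - constc γ))

/-- `G_θ(z) = A (1 - z) ^ (-c) exp (a (1 - z) ^ (-b))`, for real `z < 1`. -/
noncomputable def genFun (γ z : ℝ) : ℝ :=
  constA γ * (1 - z) ^ (-constc γ) * Real.exp (consta γ * (1 - z) ^ (-constb γ))

/-- The parameters `θ_n = [z ^ (n - 1)] G_θ(z)`, `n ≥ 1`: Taylor coefficients of `G_θ` at `0`.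
The value at `n = 0` is irrelevant. -/
noncomputable def theta (γ : ℝ) (n : ℕ) : ℝ :=
  iteratedDeriv (n - 1) (genFun γ) 0 / ((n - 1).factorial : ℝ)

end WeightedPerm

/-!
Counting permutations by cycle type turns both claims into statements about the normalizations
`hₙ`, which satisfy `n hₙ = ∑ⱼ θⱼ hₙ₋ⱼ` (`h_recurrence`), i.e. `H' = Y H` for the generating
function, where `Y = G_θ`. Likewise `G_θ' = Y₀ G_θ` with `Y₀ = c (1 - z)⁻¹ + a b (1 - z) ^ (-b - 1)`,
whose coefficients are at least `1`, nondecreasing, and have consecutive ratios tending to `1`. The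
solution inherits from a logarithmic derivative with positive nondecreasing coefficients that the
ratios tend to `1` (`ExpRecurrence.tendsto_ratio`), and also the monotonicity if the coefficients are
at least `1` (`ExpRecurrence.monotone`). Hence `θⱼ > 0` is nondecreasing, `θⱼ / θⱼ₊₁ → 1`, and
`hₙ / hₙ₊₁ → 1`.

*Cycle counts.* The probability that `Rᵢ = mᵢ` for all `i ≤ k` is `∏ᵢ (θᵢ / i) ^ mᵢ / mᵢ!` times
`h'ₙ₋ₘ / hₙ`, where `m = ∑ᵢ i mᵢ` and `h'` is the normalization for the weights with `θ₁, …, θₖ`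
replaced by `0` (`law_cycleCount`). The generating function of `h'` is
`exp (-∑ᵢ θᵢ zⁱ / i) H(z)`, and since `hₙ / hₙ₊₁ → 1` the entire factor can be evaluated at
`z = 1`: `h'ₙ / hₙ → exp (-∑ᵢ θᵢ / i)` (`tendsto_h_tailWeights`). So the finite-dimensional
probabilities converge to those of independent Poisson variables, which determines weak convergence
on the product space.

*First cycle.* The law of `L₁` is `j ↦ θⱼ hₙ₋ⱼ / (n hₙ)` (`law_firstCycleLength`). Choose the tilting
parameter `s` by `∑ⱼ θⱼ (1 - s)ʲ = n`, so that `qⱼ = θⱼ (1 - s)ʲ / n` is a probability on the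
positive integers. As the series is known in closed form, comparing it with its value at `κ s` gives
Chernoff bounds: `q` is concentrated near `a b s ^ (-b - 1)`, with an error `exp (-η s ^ (-b))`,
which is a negative power of `n` because `log n ∼ a s ^ (-b)` (`exists_tail_bound`). It remains to
see that passing from `q` to the law of `L₁` costs less than any power of `n`: the numbers
`vₖ = hₖ (1 - s)ᵏ` satisfy the renewal equation `k vₖ = n ∑ⱼ qⱼ vₖ₋ⱼ`, and `vₖ ≤ n ^ o(1) vₙ` for
`k ≤ n` (`eventually_h_comparison`). This follows from a maximum principle, a minimum principle, and
the fact that every distance in a suitable window is covered by `O(1 / δ)` jumps with lengths within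
a factor `1 + δ` of the centre (`renewal_comparison`). Each jump has probability at least
`n ^ (-O(δ²))`, because `θⱼ ≥ exp ((1 - o(1)) j ^ γ)` and `j ^ γ - s j` is stationary at the centre
(`eventually_le_term`), so that the total loss is `n ^ O(δ)`. Finally `log n ∼ a s ^ (-b)` turns the
centre into `((1 - γ)⁻¹ log n) ^ (1 / γ)` (`tendsto_centre_div`).
-/

namespace WeightedPerm

/-! ### Weights of permutations and partitions -/

/-- The reciprocal of the size of the centralizer of a permutation of `n` elements whose cycle
lengths, fixed points included, form the multiset `m`, i.e. `∏ᵢ i ^ (-mᵢ) / mᵢ!`. -/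
noncomputable def cycleDensity (n : ℕ) (m : Multiset ℕ) : ℝ :=
  ∏ i ∈ Finset.Icc 1 n, (1 / (i : ℝ)) ^ m.count i / ((m.count i).factorial : ℝ)

/-- The weight of a partition in the sum `h θ n = ∑_p ∏ᵢ (θᵢ / i) ^ pᵢ / pᵢ!`, where `pᵢ` is the
multiplicity of the part `i`. -/
noncomputable def partWeight (θ : ℕ → ℝ) (n : ℕ) (m : Multiset ℕ) : ℝ :=
  ∏ i ∈ Finset.Icc 1 n, (θ i / (i : ℝ)) ^ m.count i / ((m.count i).factorial : ℝ)

lemma card_partition_eq {α : Type*} [Fintype α] [DecidableEq α] {n : ℕ}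
    (hn : Fintype.card α = n) (p : n.Partition) :
    (((Finset.univ.filter fun σ : Equiv.Perm α => σ.partition.parts = p.parts).card : ℕ) : ℝ) =
      n.factorial * cycleDensity n p.parts := by
  classical
  set m := p.parts.filter (fun i => 2 ≤ i) with hm
  have hpos : ∀ i ∈ p.parts, 1 ≤ i := fun i hi => p.parts_pos hi
  have hsplit : p.parts = m + Multiset.replicate (p.parts.count 1) 1 := by
    ext i
    rw [Multiset.count_add, hm, Multiset.count_filter, Multiset.count_replicate]
    rcases Nat.lt_trichotomy i 1 with h | h | h
    · obtain rfl : i = 0 := by omega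
      have : Multiset.count 0 p.parts = 0 := Multiset.count_eq_zero.2 fun h => by
        have := hpos 0 h; omega
      simp [this]
    · subst h; simp
    · have h1 : (1 : ℕ) ≠ i := by omega
      have h2 : 2 ≤ i := h
      simp [h1, h2]
  have hsum : m.sum + p.parts.count 1 = n := by
    have := p.parts_sum
    rw [hsplit] at this
    simpa [Multiset.sum_replicate] using this
  have hset : (Finset.univ.filter fun σ : Equiv.Perm α => σ.partition.parts = p.parts) =
      Finset.univ.filter fun σ : Equiv.Perm α => σ.cycleType = m := by
    ext σ
    simp only [Finset.mem_filter, Finset.mem_univ, true_and]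
    constructor
    · intro h
      rw [hm, ← h, Equiv.Perm.filter_parts_partition_eq_cycleType]
    · intro h
      have : n - m.sum = p.parts.count 1 := by omega
      rw [Equiv.Perm.parts_partition, ← Equiv.Perm.sum_cycleType, h, hn, this, ← hsplit]
  have hcard := Equiv.Perm.card_of_cycleType_mul_eq α m
  rw [if_pos ⟨by omega, fun a ha => (Multiset.mem_filter.1 ha).2⟩] at hcard
  have hc1 : Fintype.card α - m.sum = p.parts.count 1 := by omega
  rw [hc1, hn] at hcard
  have hle : ∀ i ∈ p.parts, i ≤ n := fun i hi => by
    have := Multiset.le_sum_of_mem hi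
    rwa [p.parts_sum] at this
  -- the denominator of Mathlib's formula, as a product over all possible lengths
  have hden : (p.parts.count 1).factorial * m.prod * (∏ i ∈ m.toFinset, (m.count i).factorial) =
      ∏ i ∈ Finset.Icc 1 n, i ^ p.parts.count i * (p.parts.count i).factorial := by
    have h1 : m.prod = ∏ i ∈ m.toFinset, i ^ m.count i := by
      rw [Finset.prod_multiset_count]
    have h2 : m.toFinset ⊆ Finset.Icc 1 n := by
      intro i hi
      rw [Multiset.mem_toFinset, hm, Multiset.mem_filter] at hi
      exact Finset.mem_Icc.2 ⟨hpos i hi.1, hle i hi.1⟩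
    rw [h1, mul_assoc, ← Finset.prod_mul_distrib]
    have h3 : ∏ i ∈ m.toFinset, i ^ m.count i * (m.count i).factorial =
        ∏ i ∈ Finset.Icc 1 n, i ^ m.count i * (m.count i).factorial := by
      refine Finset.prod_subset h2 fun i _ hi => ?_
      have : m.count i = 0 := by simpa [Multiset.mem_toFinset] using hi
      simp [this]
    rw [h3]
    rcases Nat.eq_zero_or_pos n with h0 | h0
    · have : p.parts.count 1 = 0 := by omega
      simp [h0, this]
    · have hmem : 1 ∈ Finset.Icc 1 n := by simp; omega
      rw [← Finset.mul_prod_erase _ _ hmem, ← Finset.mul_prod_erase _ _ hmem, ← mul_assoc]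
      have hc : m.count 1 = 0 := by rw [hm, Multiset.count_filter]; simp
      congr 1
      · simp [hc]
      · refine Finset.prod_congr rfl fun i hi => ?_
        have hi' : 2 ≤ i := by
          simp only [Finset.mem_erase, Finset.mem_Icc] at hi; omega
        rw [hm, Multiset.count_filter, if_pos hi']
  rw [hden] at hcard
  rw [hset, cycleDensity]
  have hcast : ((Finset.univ.filter fun σ : Equiv.Perm α => σ.cycleType = m).card : ℝ) *
      (∏ i ∈ Finset.Icc 1 n, (i : ℝ) ^ p.parts.count i * ((p.parts.count i).factorial : ℝ)) =
      (n.factorial : ℝ) := by exact_mod_cast hcard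
  rw [← hcast, mul_assoc, ← Finset.prod_mul_distrib]
  conv_lhs => rw [← mul_one ((Finset.univ.filter fun σ : Equiv.Perm α => σ.cycleType = m).card : ℝ)]
  congr 1
  symm
  refine Finset.prod_eq_one fun i hi => ?_
  have : (i : ℝ) ≠ 0 := by
    have := (Finset.mem_Icc.1 hi).1; positivity
  have h2 : ((p.parts.count i).factorial : ℝ) ≠ 0 := by positivity
  rw [one_div, inv_pow]
  field_simp

/-- A sum of a function of the cycle type over all permutations is a sum over partitions. -/
lemma sum_perm_eq_sum_partition {α : Type*} [Fintype α] [DecidableEq α] {n : ℕ}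
    (hn : Fintype.card α = n) (F : Multiset ℕ → ℝ) :
    ∑ σ : Equiv.Perm α, F σ.partition.parts =
      n.factorial * ∑ p : n.Partition, cycleDensity n p.parts * F p.parts := by
  subst hn
  rw [← Finset.sum_fiberwise Finset.univ (fun σ : Equiv.Perm α => σ.partition), Finset.mul_sum]
  refine Finset.sum_congr rfl fun p _ => ?_
  have hcard := card_partition_eq rfl p
  simp only [← Nat.Partition.ext_iff] at hcard
  rw [Finset.sum_congr rfl (g := fun _ => F p.parts), Finset.sum_const, nsmul_eq_mul,
    hcard, mul_assoc]
  intro σ hσ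
  rw [(Finset.mem_filter.1 hσ).2]

lemma weight_eq (θ : ℕ → ℝ) {n : ℕ} (σ : Equiv.Perm (Fin n)) :
    weight θ σ = ∏ j ∈ Finset.Icc 1 n, θ j ^ σ.partition.parts.count j := rfl

lemma cycleDensity_mul (θ : ℕ → ℝ) (n : ℕ) (m : Multiset ℕ) :
    cycleDensity n m * ∏ j ∈ Finset.Icc 1 n, θ j ^ m.count j = partWeight θ n m := by
  rw [cycleDensity, partWeight, ← Finset.prod_mul_distrib]
  refine Finset.prod_congr rfl fun i _ => ?_
  rw [div_pow, div_pow, one_pow]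
  ring

lemma sum_weight_mul (θ : ℕ → ℝ) (n : ℕ) (F : Multiset ℕ → ℝ) :
    ∑ σ : Equiv.Perm (Fin n), weight θ σ * F σ.partition.parts =
      n.factorial * ∑ p : n.Partition, partWeight θ n p.parts * F p.parts := by
  have := sum_perm_eq_sum_partition (Fintype.card_fin n)
    (fun m => (∏ j ∈ Finset.Icc 1 n, θ j ^ m.count j) * F m)
  simp only [weight_eq]
  rw [this]
  simp only [← mul_assoc, cycleDensity_mul]

lemma h_eq_sum_partition (θ : ℕ → ℝ) (n : ℕ) :
    h θ n = ∑ p : n.Partition, partWeight θ n p.parts := by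
  have := sum_weight_mul θ n (fun _ => 1)
  simp only [mul_one] at this
  rw [h, this, ← mul_assoc, one_div, inv_mul_cancel₀ (by positivity), one_mul]

lemma h_zero (θ : ℕ → ℝ) : h θ 0 = 1 := by
  simp [h, weight]

lemma partWeight_of_le (θ : ℕ → ℝ) {n N : ℕ} (hnN : n ≤ N) (p : n.Partition) :
    partWeight θ N p.parts = partWeight θ n p.parts := by
  rw [partWeight, partWeight]
  symm
  refine Finset.prod_subset (Finset.Icc_subset_Icc le_rfl hnN) fun i hi hi' => ?_
  have : p.parts.count i = 0 := Multiset.count_eq_zero.2 fun hmem => by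
    have := Multiset.le_sum_of_mem hmem
    rw [p.parts_sum] at this
    simp only [Finset.mem_Icc] at hi hi'
    omega
  simp [this]

lemma partWeight_cons (θ : ℕ → ℝ) {n j : ℕ} (hj : j ∈ Finset.Icc 1 n) (m : Multiset ℕ) :
    ((j * (j ::ₘ m).count j : ℕ) : ℝ) * partWeight θ n (j ::ₘ m) = θ j * partWeight θ n m := by
  rw [partWeight, partWeight, ← Finset.mul_prod_erase _ _ hj, ← Finset.mul_prod_erase _ _ hj]
  have h1 : ∏ i ∈ (Finset.Icc 1 n).erase j, (θ i / (i : ℝ)) ^ (j ::ₘ m).count i /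
      (((j ::ₘ m).count i).factorial : ℝ) =
      ∏ i ∈ (Finset.Icc 1 n).erase j, (θ i / (i : ℝ)) ^ m.count i /
      ((m.count i).factorial : ℝ) := by
    refine Finset.prod_congr rfl fun i hi => ?_
    rw [Multiset.count_cons_of_ne (Finset.ne_of_mem_erase hi)]
  rw [h1, ← mul_assoc, ← mul_assoc]
  congr 1
  rw [Multiset.count_cons_self]
  have hj0 : (j : ℝ) ≠ 0 := by
    have := (Finset.mem_Icc.1 hj).1; positivity
  have h2 : ((m.count j).factorial : ℝ) ≠ 0 := by positivity
  rw [Nat.factorial_succ, pow_succ]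
  push_cast
  field_simp

/-- Marking an element of a cycle of length `j` and removing that cycle. -/
lemma sum_partWeight_mul_count (θ : ℕ → ℝ) {n j : ℕ} (hj : j ∈ Finset.Icc 1 n) :
    ∑ p : n.Partition, partWeight θ n p.parts * ((j * p.parts.count j : ℕ) : ℝ) =
      θ j * h θ (n - j) := by
  classical
  obtain ⟨hj1, hjn⟩ := Finset.mem_Icc.1 hj
  have h1 : ∑ p : n.Partition, partWeight θ n p.parts * ((j * p.parts.count j : ℕ) : ℝ) =
      ∑ p : {p : n.Partition // j ∈ p.parts},
        partWeight θ n p.1.parts * ((j * p.1.parts.count j : ℕ) : ℝ) := by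
    rw [← Finset.sum_subtype (Finset.univ.filter fun p : n.Partition => j ∈ p.parts)
      (fun p => by simp)
      (fun p : n.Partition => partWeight θ n p.parts * ((j * p.parts.count j : ℕ) : ℝ))]
    symm
    refine Finset.sum_filter_of_ne fun p _ hp => ?_
    contrapose! hp
    simp [Multiset.count_eq_zero.2 hp]
  rw [h1, h_eq_sum_partition, Finset.mul_sum]
  rw [← (Nat.Partition.partitionWithPartEquiv hj1 hjn).symm.sum_comp]
  refine Finset.sum_congr rfl fun q _ => ?_
  rw [Nat.Partition.partitionWithPartEquiv_symm_apply_parts, mul_comm, partWeight_cons θ hj,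
    partWeight_of_le θ (Nat.sub_le n j) q]

/-- The recurrence `n hₙ = ∑ⱼ θⱼ hₙ₋ⱼ`, i.e. `z H'(z) = (∑ⱼ θⱼ zʲ) H(z)`. -/
lemma h_recurrence (θ : ℕ → ℝ) (n : ℕ) :
    (n : ℝ) * h θ n = ∑ j ∈ Finset.Icc 1 n, θ j * h θ (n - j) := by
  rw [← Finset.sum_congr rfl fun j hj => sum_partWeight_mul_count θ hj, Finset.sum_comm,
    h_eq_sum_partition, Finset.mul_sum]
  refine Finset.sum_congr rfl fun p _ => ?_
  rw [← Finset.mul_sum, mul_comm]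
  congr 1
  have : p.parts.sum = ∑ j ∈ Finset.Icc 1 n, p.parts.count j • j := by
    refine Finset.sum_multiset_count_of_subset p.parts _ fun i hi => ?_
    rw [Multiset.mem_toFinset] at hi
    have h1 := Multiset.le_sum_of_mem hi
    rw [p.parts_sum] at h1
    exact Finset.mem_Icc.2 ⟨p.parts_pos hi, h1⟩
  rw [p.parts_sum] at this
  conv_lhs => rw [this]
  push_cast
  exact Finset.sum_congr rfl fun j _ => by simp [mul_comm]

/-! ### The first cycle and the short cycles -/

/-- The length of the cycle of `σ` through `x`. -/
noncomputable def cycleLength {α : Type*} (σ : Equiv.Perm α) (x : α) : ℕ :=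
  {y | σ.SameCycle x y}.ncard

lemma cycleLength_conj {α : Type*} (σ g : Equiv.Perm α) (x : α) :
    cycleLength (g * σ * g⁻¹) (g x) = cycleLength σ x := by
  have : {y | (g * σ * g⁻¹).SameCycle (g x) y} = g '' {y | σ.SameCycle x y} := by
    ext y
    have hx : g⁻¹ (g x) = x := g.symm_apply_apply x
    simp only [Set.mem_ofPred_eq, Equiv.Perm.sameCycle_conj, hx, Set.mem_image]
    constructor
    · intro h
      exact ⟨_, h, g.apply_symm_apply y⟩
    · rintro ⟨z, hz, rfl⟩
      rwa [show g⁻¹ (g z) = z from g.symm_apply_apply z]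
  rw [cycleLength, this, Set.ncard_image_of_injective _ g.injective, cycleLength]

lemma cycleLength_of_fixed {α : Type*} {σ : Equiv.Perm α} {x : α} (hx : σ x = x) :
    cycleLength σ x = 1 := by
  have : {y | σ.SameCycle x y} = {x} := by
    ext y
    simp only [Set.mem_ofPred_eq, Set.mem_singleton_iff]
    constructor
    · intro h
      exact (h.eq_of_left hx).symm
    · rintro rfl
      exact Equiv.Perm.SameCycle.refl _ _
  rw [cycleLength, this, Set.ncard_singleton]

lemma cycleLength_of_moved {α : Type*} [Fintype α] [DecidableEq α] {σ : Equiv.Perm α} {x : α}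
    (hx : σ x ≠ x) : cycleLength σ x = (σ.cycleOf x).support.card := by
  have : {y | σ.SameCycle x y} = ((σ.cycleOf x).support : Set α) := by
    ext y
    rw [Set.mem_ofPred_eq, Finset.mem_coe, Equiv.Perm.mem_support_cycleOf_iff,
      Equiv.Perm.mem_support]
    exact ⟨fun h => ⟨h, hx⟩, fun h => h.1⟩
  rw [cycleLength, this, Set.ncard_coe_finset]

/-- The cycles of length `j` cover `j R_j` elements. -/
lemma card_cycleLength_eq {α : Type*} [Fintype α] [DecidableEq α] (σ : Equiv.Perm α) {j : ℕ}
    (hj : 1 ≤ j) :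
    (Finset.univ.filter fun x => cycleLength σ x = j).card = j * σ.partition.parts.count j := by
  have hmv : ∀ x, σ x ≠ x → 2 ≤ cycleLength σ x := fun x hx => by
    rw [cycleLength_of_moved hx]
    exact (σ.isCycle_cycleOf hx).two_le_card_support
  rw [Equiv.Perm.parts_partition, Multiset.count_add, Multiset.count_replicate]
  rcases hj.eq_or_lt with rfl | hj2
  · have h1 : (Finset.univ.filter fun x => cycleLength σ x = 1) = σ.supportᶜ := by
      ext x
      simp only [Finset.mem_filter, Finset.mem_univ, true_and, Finset.mem_compl,
        Equiv.Perm.mem_support, not_not]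
      refine ⟨fun h => ?_, cycleLength_of_fixed⟩
      by_contra hx
      have := hmv x hx
      omega
    have h2 : σ.cycleType.count 1 = 0 := Multiset.count_eq_zero.2 fun h => by
      have := Equiv.Perm.two_le_of_mem_cycleType h
      omega
    rw [h1, Finset.card_compl, h2]
    simp
  · have h0 : (1 : ℕ) ≠ j := by omega
    rw [if_neg h0, add_zero, Equiv.Perm.cycleType_def, Multiset.count_map]
    have h1 : (Finset.univ.filter fun x => cycleLength σ x = j) =
        (σ.cycleFactorsFinset.filter fun c => c.support.card = j).biUnion
          fun c => c.support := by
      ext x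
      simp only [Finset.mem_filter, Finset.mem_univ, true_and, Finset.mem_biUnion]
      constructor
      · intro h
        have hx : σ x ≠ x := fun hx => by
          rw [cycleLength_of_fixed hx] at h
          omega
        refine ⟨σ.cycleOf x, ⟨?_, ?_⟩, ?_⟩
        · rwa [Equiv.Perm.cycleOf_mem_cycleFactorsFinset_iff, Equiv.Perm.mem_support]
        · rw [← cycleLength_of_moved hx, h]
        · rw [Equiv.Perm.mem_support_cycleOf_iff, Equiv.Perm.mem_support]
          exact ⟨Equiv.Perm.SameCycle.refl _ _, hx⟩
      · rintro ⟨c, ⟨hc, hcj⟩, hxc⟩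
        have h2 := (Equiv.Perm.cycle_is_cycleOf hxc hc)
        have hx : σ x ≠ x := by
          rw [← Equiv.Perm.mem_support]
          exact Equiv.Perm.mem_cycleFactorsFinset_support_le hc hxc
        rw [cycleLength_of_moved hx, ← h2, hcj]
    rw [h1, Finset.card_biUnion]
    · rw [Finset.sum_congr rfl (g := fun _ => j)
        (fun c hc => (Finset.mem_filter.1 hc).2), Finset.sum_const, smul_eq_mul, mul_comm]
      congr 1
      rw [Finset.card_def, Finset.filter_val]
      congr 1
      refine Multiset.filter_congr fun c _ => ?_
      simp [eq_comm]
    · intro c hc d hd hcd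
      exact Equiv.Perm.disjoint_iff_disjoint_support.1
        (σ.cycleFactorsFinset_pairwise_disjoint (Finset.mem_filter.1 hc).1
          (Finset.mem_filter.1 hd).1 hcd)

lemma firstCycleLength_eq {n : ℕ} (hn : 0 < n) (σ : Equiv.Perm (Fin n)) :
    firstCycleLength σ = cycleLength σ ⟨0, hn⟩ := by
  simp [firstCycleLength, cycleLength, hn]

lemma weight_conj (θ : ℕ → ℝ) {n : ℕ} (σ g : Equiv.Perm (Fin n)) :
    weight θ (g * σ * g⁻¹) = weight θ σ := by
  have h : (g * σ * g⁻¹).partition = σ.partition :=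
    Equiv.Perm.partition_eq_of_isConj.1 (isConj_iff.2 ⟨g, rfl⟩).symm
  rw [weight_eq, weight_eq, h]

/-- The weights are invariant under conjugation, so that the first cycle has the same length
distribution as the cycle through a uniformly chosen element. -/
lemma sum_weight_firstCycleLength (θ : ℕ → ℝ) {n j : ℕ} (hj : j ∈ Finset.Icc 1 n) :
    (n : ℝ) * ∑ σ : Equiv.Perm (Fin n), (if firstCycleLength σ = j then weight θ σ else 0) =
      n.factorial * (θ j * h θ (n - j)) := by
  obtain ⟨hj1, hjn⟩ := Finset.mem_Icc.1 hj
  have hn : 0 < n := by omega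
  have hsym : ∀ x : Fin n,
      ∑ σ : Equiv.Perm (Fin n), (if cycleLength σ x = j then weight θ σ else 0) =
        ∑ σ : Equiv.Perm (Fin n), (if firstCycleLength σ = j then weight θ σ else 0) := by
    intro x
    refine Fintype.sum_equiv (MulAut.conj (Equiv.swap x ⟨0, hn⟩)).toEquiv _ _ fun σ => ?_
    have h1 := cycleLength_conj σ (Equiv.swap x ⟨0, hn⟩) x
    rw [Equiv.swap_apply_left] at h1
    have h2 : (MulAut.conj (Equiv.swap x ⟨0, hn⟩)).toEquiv σ =
      Equiv.swap x ⟨0, hn⟩ * σ * (Equiv.swap x ⟨0, hn⟩)⁻¹ := rfl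
    simp only [h2, firstCycleLength_eq hn, weight_conj, h1]
  have h2 : (n : ℝ) * ∑ σ : Equiv.Perm (Fin n), (if firstCycleLength σ = j then weight θ σ else 0)
      = ∑ x : Fin n, ∑ σ : Equiv.Perm (Fin n),
          (if cycleLength σ x = j then weight θ σ else 0) := by
    rw [Finset.sum_congr rfl fun x _ => hsym x]
    simp
  rw [h2, Finset.sum_comm, ← sum_partWeight_mul_count θ hj, ← sum_weight_mul θ n
    fun m => ((j * m.count j : ℕ) : ℝ)]
  refine Finset.sum_congr rfl fun σ _ => ?_
  rw [← Finset.sum_filter, Finset.sum_const, card_cycleLength_eq σ hj1, nsmul_eq_mul, mul_comm]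

lemma firstCycleLength_mem {n : ℕ} (hn : 0 < n) (σ : Equiv.Perm (Fin n)) :
    firstCycleLength σ ∈ Finset.Icc 1 n := by
  rw [firstCycleLength_eq hn, cycleLength, Finset.mem_Icc]
  constructor
  · exact (Set.ncard_pos (Set.toFinite _)).2 ⟨_, Equiv.Perm.SameCycle.refl _ _⟩
  · refine (Set.ncard_le_ncard (Set.subset_univ _)).trans ?_
    simp [Set.ncard_univ]

/-- `θ` with its first `k` entries replaced by zero. -/
noncomputable def tailWeights (k : ℕ) (θ : ℕ → ℝ) (j : ℕ) : ℝ := if j ≤ k then 0 else θ j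

/-- The multiset with `m i` copies of each `i` between `1` and `k`. -/
def smallParts (k : ℕ) (m : ℕ → ℕ) : Multiset ℕ :=
  ∑ i ∈ Finset.Icc 1 k, Multiset.replicate (m i) i

lemma count_smallParts (k : ℕ) (m : ℕ → ℕ) (j : ℕ) :
    (smallParts k m).count j = if j ∈ Finset.Icc 1 k then m j else 0 := by
  rw [smallParts, Multiset.count_sum']
  simp only [Multiset.count_replicate]
  rw [Finset.sum_ite_eq']

lemma sum_smallParts (k : ℕ) (m : ℕ → ℕ) :
    (smallParts k m).sum = ∑ i ∈ Finset.Icc 1 k, m i * i := by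
  rw [smallParts, Multiset.sum_sum]
  simp [Multiset.sum_replicate]

lemma partWeight_add_smallParts (θ : ℕ → ℝ) {k n : ℕ} (hk : k ≤ n) (m : ℕ → ℕ) (q : Multiset ℕ)
    (hq : ∀ i ∈ Finset.Icc 1 k, q.count i = 0) :
    partWeight θ n (q + smallParts k m) =
      (∏ i ∈ Finset.Icc 1 k, (θ i / (i : ℝ)) ^ m i / ((m i).factorial : ℝ)) *
        partWeight (tailWeights k θ) n q := by
  have hsub : Finset.Icc 1 k ⊆ Finset.Icc 1 n := Finset.Icc_subset_Icc le_rfl hk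
  rw [partWeight, partWeight, ← Finset.prod_sdiff hsub, ← Finset.prod_sdiff hsub, mul_comm]
  have h1 : ∏ i ∈ Finset.Icc 1 k, (tailWeights k θ i / (i : ℝ)) ^ q.count i /
      ((q.count i).factorial : ℝ) = 1 :=
    Finset.prod_eq_one fun i hi => by simp [hq i hi]
  rw [h1, mul_one]
  congr 1
  · refine Finset.prod_congr rfl fun i hi => ?_
    rw [Multiset.count_add, hq i hi, count_smallParts, if_pos hi, zero_add]
  · refine Finset.prod_congr rfl fun i hi => ?_
    have hi' : ¬ i ∈ Finset.Icc 1 k := (Finset.mem_sdiff.1 hi).2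
    have hi2 := Finset.mem_Icc.1 (Finset.mem_sdiff.1 hi).1
    have hik : ¬ i ≤ k := fun h => hi' (Finset.mem_Icc.2 ⟨hi2.1, h⟩)
    rw [Multiset.count_add, count_smallParts, if_neg hi', add_zero, tailWeights, if_neg hik]

lemma partWeight_tailWeights_eq_zero (θ : ℕ → ℝ) {k n : ℕ} (hk : k ≤ n) (q : Multiset ℕ)
    (hq : ∃ i ∈ Finset.Icc 1 k, q.count i ≠ 0) : partWeight (tailWeights k θ) n q = 0 := by
  obtain ⟨i, hi, hne⟩ := hq
  have hi' := Finset.mem_Icc.1 hi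
  refine Finset.prod_eq_zero (i := i) (Finset.mem_Icc.2 ⟨hi'.1, hi'.2.trans hk⟩) ?_
  simp [tailWeights, hi'.2, hne]

open Classical in
/-- The total weight of the permutations with prescribed numbers of cycles of length at most `k`:
these cycles are chosen first, and the remaining elements are permuted without short cycles. -/
lemma sum_weight_cycleCount (θ : ℕ → ℝ) {k n : ℕ} (m : ℕ → ℕ) (hk : k ≤ n)
    (hn : ∑ i ∈ Finset.Icc 1 k, m i * i ≤ n) :
    ∑ σ : Equiv.Perm (Fin n),
        (if ∀ i ∈ Finset.Icc 1 k, cycleCount σ i = m i then weight θ σ else 0) =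
      n.factorial * ((∏ i ∈ Finset.Icc 1 k, (θ i / (i : ℝ)) ^ m i / ((m i).factorial : ℝ)) *
        h (tailWeights k θ) (n - ∑ i ∈ Finset.Icc 1 k, m i * i)) := by
  have h0 := sum_weight_mul θ n
    fun c => if ∀ i ∈ Finset.Icc 1 k, c.count i = m i then 1 else 0
  simp only [mul_ite, mul_one, mul_zero] at h0
  refine Eq.trans (Finset.sum_congr rfl fun σ _ => ?_) (h0.trans ?_)
  · unfold cycleCount
    congr
  congr 1
  set M := ∑ i ∈ Finset.Icc 1 k, m i * i with hM
  rw [h_eq_sum_partition, Finset.mul_sum, ← Finset.sum_filter]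
  rw [← Finset.sum_filter_of_ne (s := (Finset.univ : Finset (n - M).Partition))
    (p := fun q => ∀ i ∈ Finset.Icc 1 k, q.parts.count i = 0)]
  swap
  · intro q _ hq
    contrapose! hq
    rw [← partWeight_of_le _ (Nat.sub_le n M), partWeight_tailWeights_eq_zero θ hk _ hq, mul_zero]
  have hle : ∀ c : Multiset ℕ, (∀ i ∈ Finset.Icc 1 k, c.count i = m i) → smallParts k m ≤ c := by
    intro c hc
    refine Multiset.le_iff_count.2 fun i => ?_
    rw [count_smallParts]
    split_ifs with hi
    · exact (hc i hi).ge
    · exact Nat.zero_le _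
  refine Finset.sum_bij'
    (i := fun p hp => (⟨p.parts - smallParts k m, fun {i} hi =>
      p.parts_pos (Multiset.mem_of_le (Multiset.sub_le_self _ _) hi), by
        have h1 := Multiset.sub_add_cancel (hle _ (Finset.mem_filter.1 hp).2)
        have h2 := congrArg Multiset.sum h1
        rw [Multiset.sum_add, p.parts_sum, sum_smallParts] at h2
        omega⟩ : (n - M).Partition))
    (j := fun q _ => (⟨q.parts + smallParts k m, fun {i} hi => by
        rcases Multiset.mem_add.1 hi with hi | hi
        · exact q.parts_pos hi
        · have h3 : (smallParts k m).count i ≠ 0 := (Multiset.count_pos.2 hi).ne'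
          rw [count_smallParts] at h3
          by_cases h4 : i ∈ Finset.Icc 1 k
          · exact (Finset.mem_Icc.1 h4).1
          · simp [h4] at h3, by
        rw [Multiset.sum_add, q.parts_sum, sum_smallParts]
        omega⟩ : n.Partition)) ?_ ?_ ?_ ?_ ?_
  · intro p hp
    simp only [Finset.mem_filter, Finset.mem_univ, true_and] at hp ⊢
    intro i hi
    rw [Multiset.count_sub, hp i hi, count_smallParts, if_pos hi, Nat.sub_self]
  · intro q hq
    simp only [Finset.mem_filter, Finset.mem_univ, true_and] at hq ⊢
    intro i hi
    rw [Multiset.count_add, hq i hi, count_smallParts, if_pos hi, zero_add]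
  · intro p hp
    exact Nat.Partition.ext (Multiset.sub_add_cancel (hle _ (Finset.mem_filter.1 hp).2))
  · intro q hq
    exact Nat.Partition.ext (Multiset.add_sub_cancel_right)
  · intro p hp
    have hp' := (Finset.mem_filter.1 hp).2
    rw [← partWeight_of_le _ (Nat.sub_le n M), ← partWeight_add_smallParts θ hk]
    · rw [Multiset.sub_add_cancel (hle _ hp')]
    · intro i hi
      rw [Multiset.count_sub, hp' i hi, count_smallParts, if_pos hi, Nat.sub_self]

/-! ### Exponential recurrences and flat sequences -/

/-- The recurrence satisfied by the power series coefficients of a solution `g` of `g' = Y g`. -/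
def ExpRecurrence (Y g : ℕ → ℝ) : Prop :=
  ∀ n : ℕ, ((n : ℝ) + 1) * g (n + 1) = ∑ j ∈ Finset.range (n + 1), Y j * g (n - j)

lemma expRecurrence_h (θ : ℕ → ℝ) : ExpRecurrence (fun j => θ (j + 1)) (h θ) := by
  intro n
  have := h_recurrence θ (n + 1)
  push_cast at this
  have h1 : Finset.Icc 1 (n + 1) = Finset.Ico 1 (n + 2) := by
    ext j; simp only [Finset.mem_Icc, Finset.mem_Ico]; omega
  rw [this, h1, Finset.sum_Ico_eq_sum_range]
  refine Finset.sum_congr rfl fun j _ => ?_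
  rw [add_comm 1 j, Nat.add_sub_add_right]

lemma ExpRecurrence.unique {Y g g' : ℕ → ℝ} (hg : ExpRecurrence Y g) (hg' : ExpRecurrence Y g')
    (h0 : g 0 = g' 0) (n : ℕ) : g n = g' n := by
  induction n using Nat.strong_induction_on with
  | _ n ih =>
    rcases n with _ | n
    · exact h0
    · have h1 : ((n : ℝ) + 1) ≠ 0 := by positivity
      refine mul_left_cancel₀ h1 ?_
      rw [hg n, hg' n]
      exact Finset.sum_congr rfl fun j _ => by rw [ih (n - j) (by omega)]

lemma ExpRecurrence.pos {Y g : ℕ → ℝ} (hg : ExpRecurrence Y g) (hY : ∀ j, 0 < Y j)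
    (h0 : 0 < g 0) (n : ℕ) : 0 < g n := by
  induction n using Nat.strong_induction_on with
  | _ n ih =>
    rcases n with _ | n
    · exact h0
    · have h1 : 0 < ((n : ℝ) + 1) * g (n + 1) := by
        rw [hg n]
        exact Finset.sum_pos (fun j _ => mul_pos (hY j) (ih _ (by omega))) (by simp)
      exact pos_of_mul_pos_right h1 (by positivity)

lemma ExpRecurrence.sub_eq {Y g : ℕ → ℝ} (hg : ExpRecurrence Y g) (k : ℕ) :
    ((k : ℝ) + 2) * g (k + 2) - ((k : ℝ) + 1) * g (k + 1) =
      Y 0 * g (k + 1) + ∑ j ∈ Finset.range (k + 1), (Y (j + 1) - Y j) * g (k - j) := by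
  have h1 := hg (k + 1)
  rw [Finset.sum_range_succ'] at h1
  simp only [Nat.add_sub_add_right, Nat.sub_zero] at h1
  push_cast at h1
  rw [hg k, show (k : ℝ) + 2 = k + 1 + 1 by ring, h1]
  simp only [sub_mul, Finset.sum_sub_distrib]
  ring

/-- If the logarithmic derivative has nondecreasing coefficients, the first of which is at least
`1`, then the coefficients are nondecreasing. -/
lemma ExpRecurrence.monotone {Y g : ℕ → ℝ} (hg : ExpRecurrence Y g) (hY : Monotone Y)
    (hY0 : 1 ≤ Y 0) (hpos : ∀ n, 0 < g n) : Monotone g := by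
  refine monotone_nat_of_le_succ fun n => ?_
  rcases n with _ | k
  · have := hg 0
    simp at this
    rw [zero_add, this]
    nlinarith [hpos 0]
  · have h1 := hg.sub_eq k
    have h2 : 0 ≤ ∑ j ∈ Finset.range (k + 1), (Y (j + 1) - Y j) * g (k - j) :=
      Finset.sum_nonneg fun j _ =>
        mul_nonneg (sub_nonneg.2 (hY (Nat.le_succ j))) (hpos _).le
    have h3 : g (k + 1) ≤ Y 0 * g (k + 1) := le_mul_of_one_le_left (hpos _).le hY0
    have h4 : ((k : ℝ) + 2) * g (k + 1) ≤ ((k : ℝ) + 2) * g (k + 2) := by linarith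
    exact le_of_mul_le_mul_left h4 (by positivity)

/-- `n gₙ` is nondecreasing when the coefficients of the logarithmic derivative are. -/
lemma ExpRecurrence.monotone_mul {Y g : ℕ → ℝ} (hg : ExpRecurrence Y g) (hY : Monotone Y)
    (hYpos : ∀ j, 0 < Y j) (hpos : ∀ n, 0 < g n) : Monotone fun n : ℕ => (n : ℝ) * g n := by
  refine monotone_nat_of_le_succ fun n => ?_
  rcases n with _ | k
  · simpa using (hpos 1).le
  · have h1 := hg.sub_eq k
    have h2 : 0 ≤ ∑ j ∈ Finset.range (k + 1), (Y (j + 1) - Y j) * g (k - j) :=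
      Finset.sum_nonneg fun j _ =>
        mul_nonneg (sub_nonneg.2 (hY (Nat.le_succ j))) (hpos _).le
    have h3 : 0 ≤ Y 0 * g (k + 1) := (mul_pos (hYpos 0) (hpos _)).le
    push_cast
    rw [add_assoc (k : ℝ) 1 1, one_add_one_eq_two]
    linarith

/-- The coefficients of a solution of `g' = Y g` inherit from those of `Y` the property that
consecutive ratios tend to `1`. The increment of `n gₙ` is a convolution of `g` with the increments
of `Y`, which are negligible compared to `Y` itself. -/
lemma ExpRecurrence.tendsto_ratio {Y g : ℕ → ℝ} (hg : ExpRecurrence Y g) (hY : Monotone Y)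
    (hYpos : ∀ j, 0 < Y j) (hpos : ∀ n, 0 < g n)
    (hlim : Tendsto (fun j => Y j / Y (j + 1)) atTop (𝓝 1)) :
    Tendsto (fun n => g n / g (n + 1)) atTop (𝓝 1) := by
  have hmono := hg.monotone_mul hY hYpos hpos
  have hup : ∀ k : ℕ, g (k + 1) / g (k + 2) ≤ 1 + 1 / ((k : ℝ) + 1) := by
    intro k
    have h1 : ((k + 1 : ℕ) : ℝ) * g (k + 1) ≤ ((k + 2 : ℕ) : ℝ) * g (k + 2) :=
      hmono (Nat.le_succ (k + 1))
    push_cast at h1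
    rw [div_le_iff₀ (hpos _)]
    have h2 : (1 + 1 / ((k : ℝ) + 1)) = ((k : ℝ) + 2) / (k + 1) := by
      field_simp; ring
    rw [h2, div_mul_eq_mul_div, le_div_iff₀ (by positivity)]
    linarith
  have hlow : ∀ ε : ℝ, 0 < ε → ∃ C : ℝ, ∀ᶠ k : ℕ in atTop,
      1 - ε - C / ((k : ℝ) + 1) ≤ g (k + 1) / g (k + 2) := by
    intro ε hε
    obtain ⟨J, hJ⟩ := eventually_atTop.1
      (hlim.eventually (lt_mem_nhds (show 1 - ε < 1 by linarith)))
    have hJ' : ∀ j, J ≤ j → Y (j + 1) - Y j ≤ ε * Y (j + 1) := fun j hj => by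
      have := (lt_div_iff₀ (hYpos (j + 1))).1 (hJ j hj)
      linarith
    refine ⟨2 * Y J, eventually_atTop.2 ⟨2 * J + 2, fun k hk => ?_⟩⟩
    have hback : ∀ j, 2 * j + 2 ≤ k → g (k - j) ≤ 2 * g (k + 2) := by
      intro j hj
      have h1 : ((k - j : ℕ) : ℝ) * g (k - j) ≤ ((k + 2 : ℕ) : ℝ) * g (k + 2) :=
        hmono (show k - j ≤ k + 2 by omega)
      have h2 : ((k + 2 : ℕ) : ℝ) ≤ ((2 * (k - j) : ℕ) : ℝ) := by
        exact_mod_cast (by omega : k + 2 ≤ 2 * (k - j))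
      have h3 : (0 : ℝ) < ((k - j : ℕ) : ℝ) := by
        exact_mod_cast (by omega : 0 < k - j)
      push_cast at h2
      refine le_of_mul_le_mul_left ?_ h3
      push_cast at h1
      nlinarith [hpos (k + 2)]
    have hback1 : g (k + 1) ≤ 2 * g (k + 2) := by
      have h1 : ((k + 1 : ℕ) : ℝ) * g (k + 1) ≤ ((k + 2 : ℕ) : ℝ) * g (k + 2) :=
        hmono (Nat.le_succ (k + 1))
      push_cast at h1
      have h3 : (0 : ℝ) < (k : ℝ) + 1 := by positivity
      refine le_of_mul_le_mul_left ?_ h3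
      have hk0 : (0 : ℝ) ≤ (k : ℝ) := by positivity
      nlinarith [hpos (k + 2)]
    have hsum : ∑ j ∈ Finset.range (k + 1), (Y (j + 1) - Y j) * g (k - j) ≤
        (∑ j ∈ Finset.range J, (Y (j + 1) - Y j) * (2 * g (k + 2))) +
          ε * (((k : ℝ) + 2) * g (k + 2)) := by
      have h1 : ((k : ℝ) + 2) * g (k + 2) =
          Y 0 * g (k + 1) + ∑ j ∈ Finset.range (k + 1), Y (j + 1) * g (k - j) := by
        have h1 := hg (k + 1)
        rw [Finset.sum_range_succ'] at h1
        simp only [Nat.add_sub_add_right, Nat.sub_zero] at h1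
        push_cast at h1
        rw [show (k : ℝ) + 2 = k + 1 + 1 by ring, h1]
        ring
      rw [h1, mul_add, Finset.mul_sum]
      have hsplit : ∑ j ∈ Finset.range (k + 1), (Y (j + 1) - Y j) * g (k - j) ≤
          ∑ j ∈ Finset.range (k + 1), ((if j < J then (Y (j + 1) - Y j) * (2 * g (k + 2)) else 0) +
            ε * (Y (j + 1) * g (k - j))) := by
        refine Finset.sum_le_sum fun j _ => ?_
        have hp := mul_pos (hYpos (j + 1)) (hpos (k - j))
        split_ifs with hj
        · have := mul_le_mul_of_nonneg_left (hback j (by omega))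
            (sub_nonneg.2 (hY (Nat.le_succ j)))
          nlinarith
        · have := mul_le_mul_of_nonneg_right (hJ' j (not_lt.1 hj)) (hpos (k - j)).le
          linarith
      rw [Finset.sum_add_distrib] at hsplit
      have hfil : ∑ j ∈ Finset.range (k + 1),
          (if j < J then (Y (j + 1) - Y j) * (2 * g (k + 2)) else 0) =
          ∑ j ∈ Finset.range J, (Y (j + 1) - Y j) * (2 * g (k + 2)) := by
        rw [← Finset.sum_filter]
        congr 1
        ext j
        simp only [Finset.mem_filter, Finset.mem_range]
        omega
      rw [hfil] at hsplit
      have := mul_pos hε (mul_pos (hYpos 0) (hpos (k + 1)))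
      linarith
    rw [← Finset.sum_mul, Finset.sum_range_sub] at hsum
    have h1 := hg.sub_eq k
    have h2 : Y 0 * g (k + 1) ≤ Y 0 * (2 * g (k + 2)) :=
      mul_le_mul_of_nonneg_left hback1 (hYpos 0).le
    have h3 : ((k : ℝ) + 2) * g (k + 2) * (1 - ε) - 2 * Y J * g (k + 2) ≤
        ((k : ℝ) + 1) * g (k + 1) := by
      nlinarith
    rw [le_div_iff₀ (hpos _)]
    have hk1 : (0 : ℝ) < (k : ℝ) + 1 := by positivity
    refine le_of_mul_le_mul_left ?_ hk1
    have h4 : ((k : ℝ) + 1) * ((1 - ε - 2 * Y J / ((k : ℝ) + 1)) * g (k + 2)) =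
        (((k : ℝ) + 1) * (1 - ε) - 2 * Y J) * g (k + 2) := by
      field_simp
    rw [h4]
    by_cases hε1 : ε ≤ 1
    · nlinarith [mul_nonneg (sub_nonneg.2 hε1) (hpos (k + 2)).le]
    · have hA : 0 < 2 * Y J * g (k + 2) := by
        have := mul_pos (hYpos J) (hpos (k + 2)); linarith
      have hB : 0 < ((k : ℝ) + 1) * g (k + 1) := mul_pos hk1 (hpos _)
      have hC : (((k : ℝ) + 1) * (1 - ε)) * g (k + 2) ≤ 0 :=
        mul_nonpos_of_nonpos_of_nonneg
          (mul_nonpos_of_nonneg_of_nonpos hk1.le (by linarith)) (hpos _).le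
      linarith
  have hinv : Tendsto (fun k : ℕ => 1 / ((k : ℝ) + 1)) atTop (𝓝 0) :=
    tendsto_one_div_add_atTop_nhds_zero_nat
  rw [← tendsto_add_atTop_iff_nat 1]
  rw [tendsto_order]
  constructor
  · intro a ha
    obtain ⟨C, hC⟩ := hlow ((1 - a) / 2) (by linarith)
    have h1 : Tendsto (fun k : ℕ => 1 - (1 - a) / 2 - C / ((k : ℝ) + 1)) atTop
        (𝓝 (1 - (1 - a) / 2 - C * 0)) := by
      refine tendsto_const_nhds.sub ?_
      simpa [div_eq_mul_inv] using hinv.const_mul C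
    filter_upwards [hC, h1.eventually (lt_mem_nhds (show a < _ by linarith))] with k h2 h3
    exact h3.trans_le h2
  · intro a ha
    have h1 : Tendsto (fun k : ℕ => 1 + 1 / ((k : ℝ) + 1)) atTop (𝓝 (1 + 0)) :=
      tendsto_const_nhds.add hinv
    filter_upwards [h1.eventually (gt_mem_nhds (show 1 + 0 < a by linarith))] with k h3
    exact (hup k).trans_lt h3

/-- The generating functions `H θ = exp (∑ⱼ θⱼ zʲ / j)` are multiplicative in `θ`. -/
lemma h_add (θ φ : ℕ → ℝ) (n : ℕ) :
    h (θ + φ) n = ∑ i ∈ Finset.range (n + 1), h φ i * h θ (n - i) := by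
  -- `g' = Y g` for the power series, the recurrence read off coefficientwise
  have hiff : ∀ Y g : ℕ → ℝ, ExpRecurrence Y g ↔
      PowerSeries.derivative ℝ (PowerSeries.mk g) = PowerSeries.mk Y * PowerSeries.mk g := by
    intro Y g
    rw [PowerSeries.ext_iff]
    refine forall_congr' fun n => ?_
    rw [PowerSeries.coeff_derivative, PowerSeries.coeff_mul, PowerSeries.coeff_mk,
      Finset.Nat.sum_antidiagonal_eq_sum_range_succ_mk]
    simp only [PowerSeries.coeff_mk]
    rw [mul_comm]
  have hprod : PowerSeries.mk (fun n => ∑ i ∈ Finset.range (n + 1), h φ i * h θ (n - i)) =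
      PowerSeries.mk (h φ) * PowerSeries.mk (h θ) := by
    ext n
    rw [PowerSeries.coeff_mul, PowerSeries.coeff_mk,
      Finset.Nat.sum_antidiagonal_eq_sum_range_succ_mk]
    simp only [PowerSeries.coeff_mk]
  refine ExpRecurrence.unique (g' := fun n => ∑ i ∈ Finset.range (n + 1), h φ i * h θ (n - i))
    (expRecurrence_h (θ + φ)) ?_ ?_ n
  · rw [hiff, hprod, Derivation.leibniz, (hiff _ _).1 (expRecurrence_h θ),
      (hiff _ _).1 (expRecurrence_h φ)]
    have : PowerSeries.mk (fun j => (θ + φ) (j + 1)) =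
        PowerSeries.mk (fun j => θ (j + 1)) + PowerSeries.mk (fun j => φ (j + 1)) := by
      ext n; simp
    rw [this]
    simp only [smul_eq_mul]
    ring
  · simp [h_zero]

/-- For weights carried by the single length `j`, the generating function is `exp (f zʲ / j)`. -/
lemma h_single {j : ℕ} (hj : 1 ≤ j) (f : ℝ) (n : ℕ) :
    h (Pi.single j f) n = if j ∣ n then (f / j) ^ (n / j) / ((n / j).factorial : ℝ) else 0 := by
  induction n using Nat.strong_induction_on with
  | _ n ih =>
    rcases Nat.eq_zero_or_pos n with rfl | hn
    · simp [h_zero]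
    have hn' : (n : ℝ) ≠ 0 := by positivity
    have hrec := h_recurrence (Pi.single j f) n
    by_cases hjn : j ≤ n
    · rw [Finset.sum_eq_single j] at hrec
      · rw [Pi.single_eq_same, ih (n - j) (by omega)] at hrec
        refine mul_left_cancel₀ hn' (hrec.trans ?_)
        have hdiv : j ∣ n - j ↔ j ∣ n := by
          rw [Nat.dvd_sub_iff_left hjn (dvd_refl j)]
        by_cases hd : j ∣ n
        · rw [if_pos (hdiv.2 hd), if_pos hd]
          obtain ⟨q, rfl⟩ := hd
          rcases q with _ | q
          · omega
          have h1 : j * (q + 1) - j = j * q := by rw [Nat.mul_succ, Nat.add_sub_cancel]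
          rw [h1, Nat.mul_div_cancel_left _ (by omega), Nat.mul_div_cancel_left _ (by omega),
            Nat.factorial_succ, pow_succ]
          have hj0 : (j : ℝ) ≠ 0 := by positivity
          have h2 : (q.factorial : ℝ) ≠ 0 := by positivity
          have h3 : (q : ℝ) + 1 ≠ 0 := by positivity
          push_cast
          field_simp
        · rw [if_neg (fun h => hd (hdiv.1 h)), if_neg hd]
          simp
      · intro i _ hij
        rw [Pi.single_eq_of_ne hij, zero_mul]
      · intro h
        exact absurd (Finset.mem_Icc.2 ⟨hj, hjn⟩) h
    · rw [Finset.sum_eq_zero] at hrec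
      · rw [if_neg]
        · exact (mul_eq_zero.1 hrec).resolve_left hn'
        · exact fun hd => hjn (Nat.le_of_dvd hn hd)
      · intro i hi
        have := (Finset.mem_Icc.1 hi).2
        rw [Pi.single_eq_of_ne (by omega), zero_mul]

lemma hasSum_h_single {j : ℕ} (hj : 1 ≤ j) (f B : ℝ) :
    HasSum (fun n => h (Pi.single j f) n * B ^ n) (Real.exp (f * B ^ j / j)) := by
  have hinj : Function.Injective fun i : ℕ => j * i := fun a b hab =>
    Nat.eq_of_mul_eq_mul_left (by omega) hab
  rw [← hinj.hasSum_iff]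
  · have h1 := NormedSpace.expSeries_div_hasSum_exp (f * B ^ j / j)
    rw [← Real.exp_eq_exp_ℝ] at h1
    refine h1.congr_fun fun i => ?_
    simp only [Function.comp_apply]
    rw [h_single hj, if_pos (Dvd.intro i rfl), Nat.mul_div_cancel_left _ (by omega), pow_mul,
      mul_div_right_comm f, mul_pow]
    ring
  · intro n hn
    rw [h_single hj, if_neg, zero_mul]
    rintro ⟨i, rfl⟩
    exact hn ⟨i, rfl⟩

lemma summable_abs_h_single {j : ℕ} (hj : 1 ≤ j) (f : ℝ) (B : ℝ) :
    Summable fun n => |h (Pi.single j f) n| * B ^ n := by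
  refine (hasSum_h_single hj |f| B).summable.congr fun n => ?_
  rw [h_single hj, h_single hj]
  split_ifs
  · rw [abs_div, abs_pow, abs_div, Nat.abs_cast, Nat.abs_cast]
  · simp

lemma tendsto_shift_ratio {g : ℕ → ℝ} (hpos : ∀ n, 0 < g n)
    (hlim : Tendsto (fun n => g n / g (n + 1)) atTop (𝓝 1)) (i : ℕ) :
    Tendsto (fun n => g (n - i) / g n) atTop (𝓝 1) := by
  induction i with
  | zero =>
    refine tendsto_const_nhds.congr fun n => ?_
    rw [Nat.sub_zero, div_self (hpos n).ne']
  | succ i ih =>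
    have h1 : Tendsto (fun n => g (n - (i + 1)) / g (n - (i + 1) + 1)) atTop (𝓝 1) :=
      hlim.comp (tendsto_sub_atTop_nat (i + 1))
    have h2 := h1.mul ih
    rw [one_mul] at h2
    refine h2.congr' ?_
    filter_upwards [eventually_ge_atTop (i + 1)] with n hn
    have h3 : n - (i + 1) + 1 = n - i := by omega
    rw [h3, div_mul_div_cancel₀ (hpos _).ne']

/-- Convolution with a rapidly decreasing sequence multiplies the growth of a flat sequence by the
sum of that sequence. -/
lemma tendsto_conv_ratio {e D g : ℕ → ℝ} {L S : ℝ} (hpos : ∀ n, 0 < g n)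
    (hlim : Tendsto (fun n => g n / g (n + 1)) atTop (𝓝 1))
    (hD : Tendsto (fun n => D n / g n) atTop (𝓝 L))
    (he : ∀ B : ℝ, Summable fun n => |e n| * B ^ n) (hS : HasSum e S) :
    Tendsto (fun n => (∑ i ∈ Finset.range (n + 1), e i * D (n - i)) / g n) atTop
      (𝓝 (S * L)) := by
  obtain ⟨B, hB⟩ := hlim.bddAbove_range
  obtain ⟨K, hK⟩ := hD.abs.bddAbove_range
  have hB' : ∀ n, g n ≤ B * g (n + 1) := fun n =>
    (div_le_iff₀ (hpos _)).1 (hB ⟨n, rfl⟩)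
  have hK' : ∀ n, |D n / g n| ≤ K := fun n => hK ⟨n, rfl⟩
  have hB0 : 0 ≤ B := (div_pos (hpos 0) (hpos 1)).le.trans (hB ⟨0, rfl⟩)
  have hK0 : 0 ≤ K := (abs_nonneg _).trans (hK' 0)
  have hBi : ∀ i n, g n ≤ B ^ i * g (n + i) := by
    intro i
    induction i with
    | zero => intro n; simp
    | succ i ih =>
      intro n
      refine (ih n).trans ?_
      rw [pow_succ, mul_assoc]
      exact mul_le_mul_of_nonneg_left (hB' (n + i)) (by positivity)
  have key : Tendsto (fun n => ∑' i, if i ≤ n then e i * (D (n - i) / g n) else 0) atTop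
      (𝓝 (∑' i, e i * L)) := by
    refine tendsto_tsum_of_dominated_convergence
      (bound := fun i => |e i| * B ^ i * K) ((he B).mul_right K) ?_ ?_
    · intro i
      have h1 : Tendsto (fun n => D (n - i) / g (n - i) * (g (n - i) / g n)) atTop
          (𝓝 (L * 1)) :=
        (hD.comp (tendsto_sub_atTop_nat i)).mul (tendsto_shift_ratio hpos hlim i)
      rw [mul_one] at h1
      refine (h1.const_mul (e i)).congr' ?_
      filter_upwards [eventually_ge_atTop i] with n hn
      rw [if_pos hn, div_mul_div_cancel₀ (hpos _).ne']
    · refine Eventually.of_forall fun n i => ?_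
      split_ifs with hi
      · have h1 : D (n - i) / g n = D (n - i) / g (n - i) * (g (n - i) / g n) := by
          rw [div_mul_div_cancel₀ (hpos _).ne']
        rw [h1, Real.norm_eq_abs, abs_mul, abs_mul, abs_of_pos (div_pos (hpos _) (hpos n)),
          mul_assoc]
        refine mul_le_mul_of_nonneg_left ?_ (abs_nonneg _)
        rw [mul_comm]
        refine mul_le_mul ?_ (hK' _) (abs_nonneg _) (by positivity)
        rw [div_le_iff₀ (hpos n)]
        have := hBi i (n - i)
        rwa [Nat.sub_add_cancel hi] at this
      · rw [norm_zero]; positivity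
  rw [hS.mul_right L |>.tsum_eq] at key
  refine key.congr fun n => ?_
  rw [tsum_eq_sum (s := Finset.range (n + 1)), Finset.sum_div]
  · refine Finset.sum_congr rfl fun i hi => ?_
    rw [if_pos (Nat.lt_succ_iff.1 (Finset.mem_range.1 hi)), mul_div_assoc]
  · intro i hi
    rw [if_neg]
    simpa [Nat.lt_succ_iff] using hi

lemma tailWeights_succ (k : ℕ) (θ : ℕ → ℝ) :
    tailWeights (k + 1) θ = tailWeights k θ + Pi.single (k + 1) (-θ (k + 1)) := by
  ext j
  rw [Pi.add_apply, Pi.single_apply, tailWeights, tailWeights]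
  by_cases h1 : j ≤ k
  · have : j ≠ k + 1 := by omega
    simp [h1, this, Nat.le_succ_of_le h1]
  · by_cases h2 : j = k + 1
    · subst h2; simp
    · have : ¬ j ≤ k + 1 := by omega
      simp [h1, h2, this]

lemma h_tailWeights_zero (θ : ℕ → ℝ) (n : ℕ) : h (tailWeights 0 θ) n = h θ n := by
  refine ExpRecurrence.unique (Y := fun j => θ (j + 1)) ?_ (expRecurrence_h θ) (by simp [h_zero]) n
  have := expRecurrence_h (tailWeights 0 θ)
  simpa [tailWeights] using this

/-- Forbidding the cycles of length at most `k` costs the factor `exp (-∑ θᵢ / i)`. -/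
lemma tendsto_h_tailWeights {θ : ℕ → ℝ} (hpos : ∀ n, 0 < h θ n)
    (hlim : Tendsto (fun n => h θ n / h θ (n + 1)) atTop (𝓝 1)) (k : ℕ) :
    Tendsto (fun n => h (tailWeights k θ) n / h θ n) atTop
      (𝓝 (∏ i ∈ Finset.Icc 1 k, Real.exp (-θ i / i))) := by
  induction k with
  | zero =>
    simp only [h_tailWeights_zero, zero_lt_one, Finset.Icc_eq_empty_of_lt, Finset.prod_empty]
    exact tendsto_const_nhds.congr fun n => (div_self (hpos n).ne').symm
  | succ k ih =>
    have hk : 1 ≤ k + 1 := by omega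
    have h1 := hasSum_h_single hk (-θ (k + 1)) 1
    simp only [one_pow, mul_one] at h1
    have h2 := tendsto_conv_ratio hpos hlim ih
      (summable_abs_h_single hk (-θ (k + 1))) h1
    rw [Finset.prod_Icc_succ_top hk, mul_comm]
    refine h2.congr fun n => ?_
    rw [tailWeights_succ, h_add]

/-! ### The laws of the first cycle and of the cycle counts -/

section law

variable {θ : ℕ → ℝ}

lemma weight_pos (hθ : ∀ j, 1 ≤ j → 0 < θ j) {n : ℕ} (σ : Equiv.Perm (Fin n)) :
    0 < weight θ σ :=
  Finset.prod_pos fun j hj => pow_pos (hθ j (Finset.mem_Icc.1 hj).1) _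

lemma h_pos (hθ : ∀ j, 1 ≤ j → 0 < θ j) (n : ℕ) : 0 < h θ n := by
  refine mul_pos (by positivity) (Finset.sum_pos (fun σ _ => weight_pos hθ σ) ?_)
  exact Finset.univ_nonempty

open Classical in
lemma law_apply (hθ : ∀ j, 1 ≤ j → 0 < θ j) (n : ℕ) (S : Set (Equiv.Perm (Fin n))) :
    law θ n S = ENNReal.ofReal
      ((∑ σ : Equiv.Perm (Fin n), if σ ∈ S then weight θ σ else 0) / (n.factorial * h θ n)) := by
  have hden : 0 < (n.factorial : ℝ) * h θ n := mul_pos (by positivity) (h_pos hθ n)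
  rw [law, Measure.finsetSum_apply, Finset.sum_div, ENNReal.ofReal_sum_of_nonneg]
  · refine Finset.sum_congr rfl fun σ _ => ?_
    rw [Measure.smul_apply, Measure.dirac_apply' _ (by trivial), smul_eq_mul]
    by_cases hσ : σ ∈ S <;> simp [hσ]
  · intro σ _
    split_ifs
    · exact div_nonneg (weight_pos hθ σ).le hden.le
    · simp

lemma isProbabilityMeasure_law (hθ : ∀ j, 1 ≤ j → 0 < θ j) (n : ℕ) :
    IsProbabilityMeasure (law θ n) := by
  refine ⟨?_⟩
  have hne : (n.factorial : ℝ) ≠ 0 := by positivity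
  rw [law_apply hθ]
  have h1 : (n.factorial : ℝ) * h θ n = ∑ σ : Equiv.Perm (Fin n), weight θ σ := by
    rw [h, ← mul_assoc, mul_one_div_cancel hne, one_mul]
  simp only [Set.mem_univ, if_true]
  rw [← h1, div_self (mul_pos (by positivity) (h_pos hθ n)).ne', ENNReal.ofReal_one]

open Classical in
/-- The length of the first cycle is `j` with probability `θⱼ hₙ₋ⱼ / (n hₙ)`. -/
lemma law_firstCycleLength (hθ : ∀ j, 1 ≤ j → 0 < θ j) {n : ℕ} (hn : 0 < n) (P : ℕ → Prop) :
    law θ n {σ | P (firstCycleLength σ)} = ENNReal.ofReal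
      (∑ j ∈ (Finset.Icc 1 n).filter P, θ j * h θ (n - j) / (n * h θ n)) := by
  rw [law_apply hθ]
  congr 1
  have hne : (n.factorial : ℝ) ≠ 0 := by positivity
  have hn0 : (n : ℝ) ≠ 0 := by positivity
  have hh := (h_pos hθ n).ne'
  have h1 : (∑ σ : Equiv.Perm (Fin n),
      if σ ∈ {σ | P (firstCycleLength σ)} then weight θ σ else 0) =
      ∑ j ∈ (Finset.Icc 1 n).filter P, ∑ σ : Equiv.Perm (Fin n),
        (if firstCycleLength σ = j then weight θ σ else 0) := by
    rw [Finset.sum_comm]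
    refine Finset.sum_congr rfl fun σ _ => ?_
    rw [Finset.sum_ite_eq]
    simp only [Finset.mem_filter, firstCycleLength_mem hn σ, true_and, Set.mem_ofPred_eq]
  rw [h1, Finset.sum_div]
  refine Finset.sum_congr rfl fun j hj => ?_
  have h2 := sum_weight_firstCycleLength θ (Finset.mem_filter.1 hj).1
  rw [div_eq_div_iff (mul_ne_zero hne hh) (mul_ne_zero hn0 hh)]
  linear_combination (h θ n) * h2

open Classical in
lemma law_cycleCount (hθ : ∀ j, 1 ≤ j → 0 < θ j) {k n : ℕ} (m : ℕ → ℕ) (hk : k ≤ n)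
    (hn : ∑ i ∈ Finset.Icc 1 k, m i * i ≤ n) :
    law θ n {σ | ∀ i ∈ Finset.Icc 1 k, cycleCount σ i = m i} = ENNReal.ofReal
      ((∏ i ∈ Finset.Icc 1 k, (θ i / (i : ℝ)) ^ m i / ((m i).factorial : ℝ)) *
        (h (tailWeights k θ) (n - ∑ i ∈ Finset.Icc 1 k, m i * i) / h θ n)) := by
  have h1 := sum_weight_cycleCount θ m hk hn
  have hne : (n.factorial : ℝ) ≠ 0 := by positivity
  rw [law_apply hθ]
  simp only [Set.mem_ofPred_eq]
  rw [h1, mul_div_mul_left _ _ hne, mul_div_assoc]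

lemma tendsto_law_cycleCount (hθ : ∀ j, 1 ≤ j → 0 < θ j)
    (hlim : Tendsto (fun n => h θ n / h θ (n + 1)) atTop (𝓝 1)) (k : ℕ) (m : ℕ → ℕ) :
    Tendsto (fun n => law θ n {σ | ∀ i ∈ Finset.Icc 1 k, cycleCount σ i = m i}) atTop
      (𝓝 (ENNReal.ofReal (∏ i ∈ Finset.Icc 1 k,
        Real.exp (-(θ i / i)) * (θ i / (i : ℝ)) ^ m i / ((m i).factorial : ℝ)))) := by
  have hpos := h_pos hθ
  set M := ∑ i ∈ Finset.Icc 1 k, m i * i with hM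
  have h1 : Tendsto (fun n => h (tailWeights k θ) (n - M) / h θ (n - M) *
      (h θ (n - M) / h θ n)) atTop (𝓝 ((∏ i ∈ Finset.Icc 1 k, Real.exp (-θ i / i)) * 1)) :=
    ((tendsto_h_tailWeights hpos hlim k).comp (tendsto_sub_atTop_nat M)).mul
      (tendsto_shift_ratio hpos hlim M)
  have h2 := h1.const_mul (∏ i ∈ Finset.Icc 1 k, (θ i / (i : ℝ)) ^ m i / ((m i).factorial : ℝ))
  rw [mul_one, ← Finset.prod_mul_distrib] at h2
  have h3 := ENNReal.tendsto_ofReal h2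
  have h4 : ∏ i ∈ Finset.Icc 1 k,
      ((θ i / (i : ℝ)) ^ m i / ((m i).factorial : ℝ)) * Real.exp (-θ i / i) =
      ∏ i ∈ Finset.Icc 1 k,
        Real.exp (-(θ i / i)) * (θ i / (i : ℝ)) ^ m i / ((m i).factorial : ℝ) :=
    Finset.prod_congr rfl fun i _ => by rw [neg_div]; ring
  rw [h4] at h3
  refine h3.congr' ?_
  filter_upwards [eventually_ge_atTop k, eventually_ge_atTop M] with n hk hn
  rw [law_cycleCount hθ m hk hn, div_mul_div_cancel₀ (hpos _).ne']

/-- If `hₙ / hₙ₊₁ → 1`, the cycle counts converge jointly to independent Poisson variables.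
Cylinders that fix finitely many coordinates form a convergence-determining π-system. -/
lemma tendstoInDistribution_cycleCount (hθ : ∀ j, 1 ≤ j → 0 < θ j)
    (hlim : Tendsto (fun n => h θ n / h θ (n + 1)) atTop (𝓝 1))
    [∀ n : ℕ, IsProbabilityMeasure (law θ n)] :
    TendstoInDistribution
      (fun (n : ℕ) (σ : Equiv.Perm (Fin n)) (i : ℕ) => cycleCount σ (i + 1))
      atTop (id : (ℕ → ℕ) → (ℕ → ℕ)) (fun n : ℕ => law θ n)
      (Measure.infinitePi fun i : ℕ =>
        poissonMeasure (Real.toNNReal (θ (i + 1) / (i + 1 : ℝ)))) := by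
  have hmeasX : ∀ n : ℕ, Measurable
      (fun (σ : Equiv.Perm (Fin n)) (i : ℕ) => cycleCount σ (i + 1)) :=
    fun n => measurable_from_top
  refine ⟨fun n => (hmeasX n).aemeasurable, aemeasurable_id, ?_⟩
  set S : Set (Set (ℕ → ℕ)) := {s | ∃ (k : ℕ) (m : ℕ → ℕ), s = {x | ∀ i, i < k → x i = m i}}
    with hSdef
  have hS : IsPiSystem S := by
    rintro _ ⟨k, m, rfl⟩ _ ⟨k', m', rfl⟩ ⟨y, hy, hy'⟩
    refine ⟨max k k', y, ?_⟩
    simp only [Set.mem_ofPred_eq] at hy hy'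
    ext x
    simp only [Set.mem_inter_iff, Set.mem_ofPred_eq]
    constructor
    · rintro ⟨h1, h2⟩ i hi
      rcases lt_max_iff.1 hi with hi | hi
      · rw [h1 i hi, hy i hi]
      · rw [h2 i hi, hy' i hi]
    · intro h1
      exact ⟨fun i hi => (h1 i (lt_max_of_lt_left hi)).trans (hy i hi),
        fun i hi => (h1 i (lt_max_of_lt_right hi)).trans (hy' i hi)⟩
  have hpi : ∀ (k : ℕ) (m : ℕ → ℕ), {x : ℕ → ℕ | ∀ i, i < k → x i = m i} =
      Set.pi (Finset.range k : Set ℕ) (fun i => {m i}) := by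
    intro k m
    ext x
    simp [Set.mem_pi]
  have hmeas : ∀ s ∈ S, MeasurableSet s := by
    rintro _ ⟨k, m, rfl⟩
    rw [hpi]
    exact MeasurableSet.pi (Finset.countable_toSet _) fun i _ => measurableSet_singleton _
  refine hS.tendsto_probabilityMeasure_of_tendsto_of_mem hmeas ?_ ?_
  · intro u hu x hx
    obtain ⟨I, t, hIt, hsub⟩ := isOpen_pi_iff.1 hu x hx
    refine ⟨{y | ∀ i, i < I.sup id + 1 → y i = x i}, ⟨_, x, rfl⟩, ?_, ?_⟩
    · rw [hpi]
      exact set_pi_mem_nhds (Finset.finite_toSet _) fun i _ => by simp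
    · intro y hy
      refine hsub fun i hi => ?_
      have : i < I.sup id + 1 := Nat.lt_succ_of_le (Finset.le_sup (f := id) hi)
      rw [hy i this]
      exact (hIt i hi).2
  · rintro _ ⟨k, m, rfl⟩
    have hms := hmeas _ ⟨k, m, rfl⟩
    have hlaw : ∀ n : ℕ, (law θ n).map
        (fun (σ : Equiv.Perm (Fin n)) (i : ℕ) => cycleCount σ (i + 1))
          {x : ℕ → ℕ | ∀ i, i < k → x i = m i} =
        law θ n {σ | ∀ i ∈ Finset.Icc 1 k, cycleCount σ i = m (i - 1)} := by
      intro n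
      rw [Measure.map_apply (hmeasX n) hms]
      congr 1
      ext σ
      simp only [Set.preimage_ofPred_eq, Set.mem_ofPred_eq, Finset.mem_Icc]
      constructor
      · rintro h1 i ⟨hi1, hik⟩
        have := h1 (i - 1) (by omega)
        rwa [Nat.sub_add_cancel hi1] at this
      · intro h1 i hi
        exact h1 (i + 1) ⟨by omega, by omega⟩
    refine (ENNReal.tendsto_toNNReal (?_ : Measure.map id _ _ ≠ ⊤)).comp
      (?_ : Tendsto (fun n : ℕ => (law θ n).map
        (fun (σ : Equiv.Perm (Fin n)) (i : ℕ) => cycleCount σ (i + 1))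
          {x : ℕ → ℕ | ∀ i, i < k → x i = m i}) atTop (𝓝 (Measure.map id _ _)))
    · rw [Measure.map_id]
      exact measure_ne_top _ _
    rw [Measure.map_id]
    simp only [hlaw]
    convert! tendsto_law_cycleCount hθ hlim k fun i => m (i - 1) using 2
    rw [hpi, Measure.infinitePi_pi _ (fun i _ => measurableSet_singleton _)]
    have hIcc : Finset.Icc 1 k = Finset.Ico 1 (k + 1) := by
      ext j; simp only [Finset.mem_Icc, Finset.mem_Ico]; omega
    rw [hIcc, Finset.prod_Ico_eq_prod_range, ENNReal.ofReal_prod_of_nonneg, Nat.add_sub_cancel]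
    · refine Finset.prod_congr rfl fun i _ => ?_
      rw [poissonMeasure_singleton, Real.coe_toNNReal, add_comm 1 i, Nat.add_sub_cancel]
      · push_cast
        rfl
      · exact (div_pos (hθ _ (by omega)) (by positivity)).le
    · intro i _
      have := (hθ (1 + i) (by omega)).le
      positivity

end law

/-! ### The weights `θ` and their generating function -/

section constants

variable {γ : ℝ}

lemma constb_pos (hγ0 : 0 < γ) (hγ1 : γ < 1) : 0 < constb γ :=
  div_pos hγ0 (sub_pos.2 hγ1)

lemma consta_pos (hγ0 : 0 < γ) (hγ1 : γ < 1) : 0 < consta γ :=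
  mul_pos (sub_pos.2 hγ1) (Real.rpow_pos_of_pos hγ0 _)

lemma one_le_constc (hγ0 : 0 < γ) (hγ1 : γ < 1) : 1 ≤ constc γ := by
  have := constb_pos hγ0 hγ1
  rw [constc]
  linarith

lemma constA_pos (hγ0 : 0 < γ) (hγ1 : γ < 1) : 0 < constA γ := by
  have hb := constb_pos hγ0 hγ1
  have ha := consta_pos hγ0 hγ1
  have hpi := Real.pi_pos
  exact mul_pos (Real.sqrt_pos.2 (by positivity)) (Real.rpow_pos_of_pos (by positivity) _)

end constants

lemma contDiffAt_one_sub_rpow (β : ℝ) {z : ℝ} (hz : z < 1) (n : WithTop ℕ∞) :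
    ContDiffAt ℝ n (fun x : ℝ => (1 - x) ^ (-β)) z :=
  ContDiffAt.rpow_const_of_ne (contDiffAt_const.sub contDiffAt_id) (sub_pos.2 hz).ne'

lemma hasDerivAt_one_sub_rpow (β : ℝ) {z : ℝ} (hz : z < 1) :
    HasDerivAt (fun x : ℝ => (1 - x) ^ (-β)) (β * (1 - z) ^ (-(β + 1))) z := by
  have h1 : HasDerivAt (fun x : ℝ => 1 - x) (-1) z := by
    simpa using (hasDerivAt_id z).const_sub 1
  have h2 := h1.rpow_const (p := -β) (Or.inl (sub_pos.2 hz).ne')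
  convert h2 using 1
  rw [show -(β + 1) = -β - 1 by ring]
  ring

lemma iteratedDeriv_one_sub_rpow (β : ℝ) (n : ℕ) {z : ℝ} (hz : z < 1) :
    iteratedDeriv n (fun x : ℝ => (1 - x) ^ (-β)) z =
      (∏ l ∈ Finset.range n, (β + l)) * (1 - z) ^ (-(β + n)) := by
  induction n generalizing z with
  | zero => simp
  | succ n ih =>
    have h1 : iteratedDeriv n (fun x : ℝ => (1 - x) ^ (-β)) =ᶠ[𝓝 z]
        fun x => (∏ l ∈ Finset.range n, (β + l)) * (1 - x) ^ (-(β + n)) := by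
      filter_upwards [Iio_mem_nhds hz] with x hx
      exact ih hx
    rw [iteratedDeriv_succ, h1.deriv_eq,
      ((hasDerivAt_one_sub_rpow (β + n) hz).const_mul _).deriv, Finset.prod_range_succ]
    push_cast
    rw [add_assoc β]
    ring

/-- The power series coefficients of the logarithmic derivative
`c (1 - z)⁻¹ + a b (1 - z) ^ (-b - 1)` of `genFun γ`. -/
noncomputable def logDerivCoeff (γ : ℝ) (i : ℕ) : ℝ :=
  constc γ + consta γ * constb γ * ∏ l ∈ Finset.range i, ((constb γ + 1 + l) / (1 + l))

section logDerivCoeff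

variable {γ : ℝ}

lemma prod_ratio_pos (hγ0 : 0 < γ) (hγ1 : γ < 1) (i : ℕ) :
    0 < ∏ l ∈ Finset.range i, ((constb γ + 1 + l) / (1 + (l : ℝ))) := by
  have hb := constb_pos hγ0 hγ1
  exact Finset.prod_pos fun l _ => by positivity

lemma logDerivCoeff_succ_sub (γ : ℝ) (i : ℕ) :
    logDerivCoeff γ (i + 1) - logDerivCoeff γ i = consta γ * constb γ *
      (∏ l ∈ Finset.range i, ((constb γ + 1 + l) / (1 + (l : ℝ)))) * (constb γ / (1 + i)) := by
  have : (1 + (i : ℝ)) ≠ 0 := by positivity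
  rw [logDerivCoeff, logDerivCoeff, Finset.prod_range_succ]
  field_simp
  ring

lemma one_le_logDerivCoeff (hγ0 : 0 < γ) (hγ1 : γ < 1) (i : ℕ) : 1 ≤ logDerivCoeff γ i := by
  have h1 := one_le_constc hγ0 hγ1
  have h2 := mul_pos (mul_pos (consta_pos hγ0 hγ1) (constb_pos hγ0 hγ1))
    (prod_ratio_pos hγ0 hγ1 i)
  rw [logDerivCoeff]
  linarith

lemma monotone_logDerivCoeff (hγ0 : 0 < γ) (hγ1 : γ < 1) : Monotone (logDerivCoeff γ) := by
  refine monotone_nat_of_le_succ fun i => ?_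
  have ha := consta_pos hγ0 hγ1
  have hb := constb_pos hγ0 hγ1
  have hp := prod_ratio_pos hγ0 hγ1 i
  rw [← sub_nonneg, logDerivCoeff_succ_sub]
  positivity

lemma tendsto_logDerivCoeff_ratio (hγ0 : 0 < γ) (hγ1 : γ < 1) :
    Tendsto (fun i => logDerivCoeff γ i / logDerivCoeff γ (i + 1)) atTop (𝓝 1) := by
  have hb := constb_pos hγ0 hγ1
  have hpos : ∀ i, 0 < logDerivCoeff γ i := fun i =>
    zero_lt_one.trans_le (one_le_logDerivCoeff hγ0 hγ1 i)
  have h1 : Tendsto (fun i : ℕ => 1 - constb γ * (1 / ((i : ℝ) + 1))) atTop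
      (𝓝 (1 - constb γ * 0)) :=
    tendsto_const_nhds.sub (tendsto_one_div_add_atTop_nhds_zero_nat.const_mul _)
  rw [mul_zero, sub_zero] at h1
  refine tendsto_of_tendsto_of_tendsto_of_le_of_le h1 tendsto_const_nhds (fun i => ?_) fun i => ?_
  · have h2 := logDerivCoeff_succ_sub γ i
    have h3 : consta γ * constb γ *
        (∏ l ∈ Finset.range i, ((constb γ + 1 + l) / (1 + (l : ℝ)))) ≤
        logDerivCoeff γ (i + 1) := by
      refine le_trans ?_ (monotone_logDerivCoeff hγ0 hγ1 (Nat.le_succ i))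
      have := one_le_constc hγ0 hγ1
      rw [logDerivCoeff]
      linarith
    have h4 := mul_le_mul_of_nonneg_right h3
      (show 0 ≤ constb γ / (1 + (i : ℝ)) by positivity)
    change 1 - constb γ * (1 / ((i : ℝ) + 1)) ≤ _
    rw [le_div_iff₀ (hpos _), mul_one_div, add_comm (i : ℝ) 1]
    linarith
  · exact (div_le_one (hpos _)).2 (monotone_logDerivCoeff hγ0 hγ1 (Nat.le_succ i))

end logDerivCoeff

/-- The logarithmic derivative of `genFun γ`. -/
noncomputable def logDerivFun (γ z : ℝ) : ℝ :=
  constc γ * (1 - z) ^ (-(1 : ℝ)) +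
    consta γ * constb γ * (1 - z) ^ (-(constb γ + 1))

lemma contDiffAt_logDerivFun (γ : ℝ) {z : ℝ} (hz : z < 1) (n : WithTop ℕ∞) :
    ContDiffAt ℝ n (logDerivFun γ) z :=
  (contDiffAt_const.mul (contDiffAt_one_sub_rpow 1 hz n)).add
    (contDiffAt_const.mul (contDiffAt_one_sub_rpow (constb γ + 1) hz n))

lemma contDiffAt_genFun (γ : ℝ) {z : ℝ} (hz : z < 1) (n : WithTop ℕ∞) :
    ContDiffAt ℝ n (genFun γ) z :=
  (contDiffAt_const.mul (contDiffAt_one_sub_rpow (constc γ) hz n)).mul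
    ((contDiffAt_const.mul (contDiffAt_one_sub_rpow (constb γ) hz n)).exp)

lemma deriv_genFun (γ : ℝ) {z : ℝ} (hz : z < 1) :
    deriv (genFun γ) z = logDerivFun γ z * genFun γ z := by
  have h1 := ((hasDerivAt_one_sub_rpow (constc γ) hz).const_mul (constA γ)).mul
    ((hasDerivAt_one_sub_rpow (constb γ) hz).const_mul (consta γ)).exp
  have h2 : HasDerivAt (genFun γ) _ z := h1
  rw [h2.deriv, logDerivFun, genFun]
  have h3 : (1 - z) ^ (-(constc γ + 1)) = (1 - z) ^ (-(1 : ℝ)) * (1 - z) ^ (-constc γ) := by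
    rw [← Real.rpow_add (sub_pos.2 hz)]
    congr 1
    ring
  rw [h3]
  ring

lemma iteratedDeriv_logDerivFun (γ : ℝ) (i : ℕ) :
    iteratedDeriv i (logDerivFun γ) 0 = i.factorial * logDerivCoeff γ i := by
  have h1 : (∏ l ∈ Finset.range i, ((1 : ℝ) + l)) = i.factorial := by
    induction i with
    | zero => simp
    | succ i ih =>
      rw [Finset.prod_range_succ, ih, Nat.factorial_succ]
      push_cast
      ring
  have h2 : iteratedDeriv i (logDerivFun γ) 0 =
      iteratedDeriv i (fun z : ℝ => constc γ * (1 - z) ^ (-(1 : ℝ))) 0 +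
      iteratedDeriv i (fun z : ℝ => consta γ * constb γ * (1 - z) ^ (-(constb γ + 1))) 0 :=
    iteratedDeriv_fun_add (contDiffAt_const.mul (contDiffAt_one_sub_rpow 1 one_pos i))
      (contDiffAt_const.mul (contDiffAt_one_sub_rpow (constb γ + 1) one_pos i))
  rw [h2, iteratedDeriv_const_mul_field, iteratedDeriv_const_mul_field,
    iteratedDeriv_one_sub_rpow _ _ one_pos, iteratedDeriv_one_sub_rpow _ _ one_pos, logDerivCoeff,
    Finset.prod_div_distrib, h1]
  have h3 : (i.factorial : ℝ) ≠ 0 := by positivity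
  simp only [sub_zero, Real.one_rpow, mul_one]
  field_simp

/-- The recurrence for the weights `θ`, from `G' = (c (1 - z)⁻¹ + a b (1 - z) ^ (-b - 1)) G`. -/
lemma expRecurrence_theta (γ : ℝ) :
    ExpRecurrence (logDerivCoeff γ) (fun i => theta γ (i + 1)) := by
  intro n
  have h1 : deriv (genFun γ) =ᶠ[𝓝 0] logDerivFun γ * genFun γ := by
    filter_upwards [Iio_mem_nhds one_pos] with z hz
    exact deriv_genFun γ hz
  simp only [theta, Nat.add_sub_cancel]
  rw [iteratedDeriv_succ', h1.iteratedDeriv_eq,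
    iteratedDeriv_mul (contDiffAt_logDerivFun γ one_pos n) (contDiffAt_genFun γ one_pos n),
    Nat.factorial_succ, Finset.sum_div, Finset.mul_sum]
  refine Finset.sum_congr rfl fun i hi => ?_
  have hi' : i ≤ n := Nat.lt_succ_iff.1 (Finset.mem_range.1 hi)
  rw [iteratedDeriv_logDerivFun]
  have h2 : (n.choose i : ℝ) * i.factorial * (n - i).factorial = n.factorial := by
    exact_mod_cast Nat.choose_mul_factorial_mul_factorial hi'
  have h3 : ((n - i).factorial : ℝ) ≠ 0 := by positivity
  have h4 : (n.factorial : ℝ) ≠ 0 := by positivity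
  have h5 : (n : ℝ) + 1 ≠ 0 := by positivity
  push_cast
  rw [mul_div_assoc', mul_div_assoc', div_eq_div_iff (by positivity) h3]
  linear_combination (((n : ℝ) + 1) * logDerivCoeff γ i * iteratedDeriv (n - i) (genFun γ) 0) * h2

section theta

variable {γ : ℝ}

lemma theta_pos (hγ0 : 0 < γ) (hγ1 : γ < 1) {j : ℕ} (hj : 1 ≤ j) : 0 < theta γ j := by
  obtain ⟨i, rfl⟩ : ∃ i, j = i + 1 := ⟨j - 1, by omega⟩
  refine (expRecurrence_theta γ).pos
    (fun i => zero_lt_one.trans_le (one_le_logDerivCoeff hγ0 hγ1 i)) ?_ i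
  have h1 := constA_pos hγ0 hγ1
  simp only [theta, zero_add, Nat.sub_self, iteratedDeriv_zero, Nat.factorial_zero, Nat.cast_one,
    div_one, genFun, sub_zero, Real.one_rpow, mul_one]
  positivity

lemma monotone_theta (hγ0 : 0 < γ) (hγ1 : γ < 1) : Monotone fun i => theta γ (i + 1) :=
  (expRecurrence_theta γ).monotone (monotone_logDerivCoeff hγ0 hγ1)
    (one_le_logDerivCoeff hγ0 hγ1 0) fun _ => theta_pos hγ0 hγ1 (by omega)

lemma tendsto_theta_ratio (hγ0 : 0 < γ) (hγ1 : γ < 1) :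
    Tendsto (fun i => theta γ (i + 1) / theta γ (i + 1 + 1)) atTop (𝓝 1) :=
  (expRecurrence_theta γ).tendsto_ratio (monotone_logDerivCoeff hγ0 hγ1)
    (fun i => zero_lt_one.trans_le (one_le_logDerivCoeff hγ0 hγ1 i))
    (fun _ => theta_pos hγ0 hγ1 (by omega)) (tendsto_logDerivCoeff_ratio hγ0 hγ1)

lemma tendsto_h_ratio (hγ0 : 0 < γ) (hγ1 : γ < 1) :
    Tendsto (fun n => h (theta γ) n / h (theta γ) (n + 1)) atTop (𝓝 1) :=
  (expRecurrence_h (theta γ)).tendsto_ratio (monotone_theta hγ0 hγ1)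
    (fun _ => theta_pos hγ0 hγ1 (by omega)) (h_pos fun _ hj => theta_pos hγ0 hγ1 hj)
    (tendsto_theta_ratio hγ0 hγ1)

/-- The Taylor series of `genFun γ` at `0` converges to `genFun γ` on `(-1, 1)`: its radius of
convergence is `1` because the ratios of the coefficients tend to `1`. -/
lemma hasSum_theta (hγ0 : 0 < γ) (hγ1 : γ < 1) {z : ℝ} (hz : |z| < 1) :
    HasSum (fun i => theta γ (i + 1) * z ^ i) (genFun γ z) := by
  set p := FormalMultilinearSeries.ofScalars ℝ (fun n => iteratedDeriv n (genFun γ) 0 / n.factorial)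
    with hp
  have hG : ∀ x : ℝ, x < 1 → AnalyticAt ℝ (genFun γ) x := fun x hx =>
    (contDiffAt_genFun γ hx ⊤).analyticAt
  have h0 : HasFPowerSeriesAt (genFun γ) p 0 := (hG 0 one_pos).hasFPowerSeriesAt
  have hrad : p.radius = 1 := by
    have := FormalMultilinearSeries.ofScalars_radius_eq_of_tendsto (r := 1) ℝ
      (fun n => iteratedDeriv n (genFun γ) 0 / n.factorial) one_ne_zero ?_
    · simpa using this
    · refine (tendsto_theta_ratio hγ0 hγ1).congr fun i => ?_
      have h1 := theta_pos hγ0 hγ1 (j := i + 1) (by omega)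
      have h2 := theta_pos hγ0 hγ1 (j := i + 1 + 1) (by omega)
      rw [← abs_of_pos h1, ← abs_of_pos h2]
      rfl
  have hball : HasFPowerSeriesOnBall p.sum p 0 1 := by
    have := p.hasFPowerSeriesOnBall (by rw [hrad]; exact one_pos)
    rwa [hrad] at this
  have heq : Set.EqOn p.sum (genFun γ) (Metric.ball 0 1) := by
    refine AnalyticOnNhd.eqOn_of_preconnected_of_eventuallyEq (𝕜 := ℝ) (z₀ := 0) ?_ ?_
      (convex_ball (0 : ℝ) 1).isPreconnected (by simp) ?_
    · intro x hx
      refine hball.analyticAt_of_mem ?_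
      rw [← ENNReal.ofReal_one, Metric.eball_ofReal]
      exact hx
    · intro x hx
      refine hG x ?_
      rw [Metric.mem_ball, dist_zero_right, Real.norm_eq_abs] at hx
      exact (abs_lt.1 hx).2
    · filter_upwards [h0.eventually_hasSum_sub, hball.eventually_hasSum_sub] with x hx hx'
      exact hx'.unique hx
  have hzmem : z ∈ Metric.ball (0 : ℝ) 1 := by
    rw [Metric.mem_ball, dist_zero_right, Real.norm_eq_abs]
    exact hz
  have hs := hball.hasSum (y := z) (by
    rw [← ENNReal.ofReal_one, Metric.eball_ofReal]
    exact hzmem)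
  rw [zero_add, heq hzmem] at hs
  refine hs.congr_fun fun i => ?_
  rw [hp, FormalMultilinearSeries.ofScalars_apply_eq, smul_eq_mul]
  rfl

end theta

/-! ### Chernoff bounds for the tilted weights -/

/-- The sum `∑ⱼ θⱼ (1 - s)ʲ`, in closed form. -/
noncomputable def tiltedSum (γ s : ℝ) : ℝ := (1 - s) * genFun γ (1 - s)

/-- The point where the terms `θⱼ (1 - s)ʲ` concentrate as `s → 0`, namely
`a b s ^ (-b - 1) = (γ / s) ^ (1 / (1 - γ))`, the maximizer of `j ^ γ - s j`. -/
noncomputable def centre (γ s : ℝ) : ℝ := consta γ * constb γ * s ^ (-(constb γ + 1))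

section tilted

variable {γ : ℝ}

lemma hasSum_tiltedSum (hγ0 : 0 < γ) (hγ1 : γ < 1) {s : ℝ} (hs0 : 0 < s) (hs1 : s < 1) :
    HasSum (fun i => theta γ (i + 1) * (1 - s) ^ (i + 1)) (tiltedSum γ s) := by
  have h1 := (hasSum_theta hγ0 hγ1 (z := 1 - s) (abs_lt.2 ⟨by linarith, by linarith⟩)).mul_left
    (1 - s)
  refine h1.congr_fun fun i => ?_
  rw [pow_succ]
  ring

lemma tiltedSum_pos (hγ0 : 0 < γ) (hγ1 : γ < 1) {s : ℝ} (hs0 : 0 < s) (hs1 : s < 1) :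
    0 < tiltedSum γ s := by
  have hA := constA_pos hγ0 hγ1
  rw [tiltedSum, genFun, sub_sub_cancel]
  have : 0 < 1 - s := by linarith
  positivity

lemma sum_le_tiltedSum (hγ0 : 0 < γ) (hγ1 : γ < 1) {s : ℝ} (hs0 : 0 < s) (hs1 : s < 1)
    {F : Finset ℕ} (hF : ∀ j ∈ F, 1 ≤ j) :
    ∑ j ∈ F, theta γ j * (1 - s) ^ j ≤ tiltedSum γ s := by
  have hs : 0 < 1 - s := by linarith
  have h1 := sum_le_hasSum (F.image fun j => j - 1) (fun i _ => by
    have := theta_pos hγ0 hγ1 (j := i + 1) (by omega)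
    positivity) (hasSum_tiltedSum hγ0 hγ1 hs0 hs1)
  rw [Finset.sum_image] at h1
  · refine le_trans (le_of_eq (Finset.sum_congr rfl fun j hj => ?_)) h1
    rw [Nat.sub_add_cancel (hF j hj)]
  · intro i hi j hj hij
    have h2 := hF i hi
    have h3 := hF j hj
    simp only at hij
    omega

lemma log_tiltedSum (hγ0 : 0 < γ) (hγ1 : γ < 1) {s : ℝ} (hs0 : 0 < s) (hs1 : s < 1) :
    Real.log (tiltedSum γ s) = Real.log (1 - s) + Real.log (constA γ) - constc γ * Real.log s +
      consta γ * s ^ (-constb γ) := by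
  have hA := constA_pos hγ0 hγ1
  have h1 : 0 < 1 - s := by linarith
  have h2 : 0 < s ^ (-constc γ) := Real.rpow_pos_of_pos hs0 _
  rw [tiltedSum, genFun, sub_sub_cancel, Real.log_mul h1.ne' (by positivity),
    Real.log_mul (by positivity) (Real.exp_pos _).ne', Real.log_mul hA.ne' h2.ne',
    Real.log_rpow hs0, Real.log_exp]
  ring

lemma tendsto_rpow_nhdsGT_zero {b : ℝ} (hb : 0 < b) :
    Tendsto (fun s : ℝ => s ^ b) (𝓝[>] 0) (𝓝 0) := by
  have := (Real.continuousAt_rpow_const 0 b (Or.inr hb.le)).tendsto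
  rw [Real.zero_rpow hb.ne'] at this
  exact this.mono_left nhdsWithin_le_nhds

lemma tendsto_rpow_neg_nhdsGT_zero {b : ℝ} (hb : 0 < b) :
    Tendsto (fun s : ℝ => s ^ (-b)) (𝓝[>] 0) atTop := by
  have h1 : Tendsto (fun s : ℝ => s ^ b) (𝓝[>] 0) (𝓝[>] 0) := by
    refine tendsto_nhdsWithin_iff.2 ⟨tendsto_rpow_nhdsGT_zero hb, ?_⟩
    filter_upwards [self_mem_nhdsWithin] with s hs
    exact Real.rpow_pos_of_pos hs b
  refine h1.inv_tendsto_nhdsGT_zero.congr' ?_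
  filter_upwards [self_mem_nhdsWithin] with s hs
  exact (Real.rpow_neg (le_of_lt hs) b).symm

lemma tendsto_log_tiltedSum (hγ0 : 0 < γ) (hγ1 : γ < 1) :
    Tendsto (fun s => Real.log (tiltedSum γ s) * s ^ constb γ) (𝓝[>] 0) (𝓝 (consta γ)) := by
  have hb := constb_pos hγ0 hγ1
  have h0 : Tendsto (fun s : ℝ => Real.log (1 - s)) (𝓝[>] 0) (𝓝 0) := by
    have : ContinuousAt (fun s : ℝ => Real.log (1 - s)) 0 :=
      ContinuousAt.log (by fun_prop) (by norm_num)
    have h := this.tendsto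
    simp only [sub_zero, Real.log_one] at h
    exact h.mono_left nhdsWithin_le_nhds
  have hp := tendsto_rpow_nhdsGT_zero hb
  have hl := tendsto_log_mul_rpow_nhdsGT_zero hb
  have h1 := (((h0.mul hp).add (hp.const_mul (Real.log (constA γ)))).sub
    (hl.const_mul (constc γ))).add_const (consta γ)
  simp only [mul_zero, add_zero, sub_zero, zero_add] at h1
  refine h1.congr' ?_
  filter_upwards [Ioo_mem_nhdsGT one_pos] with s hs
  have h2 : s ^ (-constb γ) * s ^ constb γ = 1 := by
    rw [← Real.rpow_add hs.1]; simp
  rw [log_tiltedSum hγ0 hγ1 hs.1 hs.2]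
  linear_combination (-consta γ) * h2

lemma tendsto_mul_nhdsGT_zero {κ : ℝ} (hκ : 0 < κ) :
    Tendsto (fun s : ℝ => κ * s) (𝓝[>] 0) (𝓝[>] 0) := by
  refine tendsto_nhdsWithin_iff.2 ⟨?_, ?_⟩
  · have h : Tendsto (fun s : ℝ => κ * s) (𝓝 0) (𝓝 (κ * 0)) := tendsto_id.const_mul κ
    rw [mul_zero] at h
    exact h.mono_left nhdsWithin_le_nhds
  · filter_upwards [self_mem_nhdsWithin] with s hs
    exact mul_pos hκ hs

lemma tendsto_log_tiltedSum_mul (hγ0 : 0 < γ) (hγ1 : γ < 1) {κ : ℝ} (hκ : 0 < κ) :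
    Tendsto (fun s => Real.log (tiltedSum γ (κ * s)) * s ^ constb γ) (𝓝[>] 0)
      (𝓝 (consta γ * κ ^ (-constb γ))) := by
  have h1 := ((tendsto_log_tiltedSum hγ0 hγ1).comp (tendsto_mul_nhdsGT_zero hκ)).mul_const
    (κ ^ (-constb γ))
  refine h1.congr' ?_
  filter_upwards [self_mem_nhdsWithin] with s hs
  have h2 : κ ^ constb γ * κ ^ (-constb γ) = 1 := by
    rw [← Real.rpow_add hκ]; simp
  simp only [Function.comp_apply]
  rw [Real.mul_rpow hκ.le (le_of_lt hs)]
  linear_combination (Real.log (tiltedSum γ (κ * s)) * s ^ constb γ) * h2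

lemma tendsto_log_one_sub_mul_div (κ : ℝ) :
    Tendsto (fun s : ℝ => Real.log (1 - κ * s) / s) (𝓝[>] 0) (𝓝 (-κ)) := by
  have h1 : HasDerivAt (fun s : ℝ => Real.log (1 - κ * s)) (-κ) 0 := by
    have h2 : HasDerivAt (fun s : ℝ => 1 - κ * s) (-κ) 0 := by
      simpa using ((hasDerivAt_id (0 : ℝ)).const_mul κ).const_sub 1
    have h3 := h2.log (by norm_num)
    simpa using h3
  have h4 := (hasDerivAt_iff_tendsto_slope.1 h1).mono_left
    (nhdsWithin_mono (0 : ℝ) (fun x (hx : 0 < x) => hx.ne'))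
  refine h4.congr fun s => ?_
  rw [slope_def_field]
  simp

/-- **Chernoff bound.** The terms `θⱼ (1 - s)ʲ` with `j` beyond `x` times the centre are compared
with the series at the parameter `κ s`: beyond means above if `κ < 1`, and below if `κ > 1`. -/
lemma eventually_sum_le_exp (hγ0 : 0 < γ) (hγ1 : γ < 1) {κ x D : ℝ} (hκ : 0 < κ)
    (hD : consta γ * (κ ^ (-constb γ) + x * constb γ * (κ - 1)) < D) :
    ∀ᶠ s in 𝓝[>] (0 : ℝ), ∀ F : Finset ℕ,
      (∀ j ∈ F, 1 ≤ j ∧ 0 ≤ (κ - 1) * (x * centre γ s - j)) →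
      ∑ j ∈ F, theta γ j * (1 - s) ^ j ≤ Real.exp (D * s ^ (-constb γ)) := by
  have h1 : Tendsto (fun s => (Real.log (tiltedSum γ (κ * s)) + x * centre γ s *
      (Real.log (1 - s) - Real.log (1 - κ * s))) * s ^ constb γ) (𝓝[>] 0)
      (𝓝 (consta γ * (κ ^ (-constb γ) + x * constb γ * (κ - 1)))) := by
    have h2 := (tendsto_log_tiltedSum_mul hγ0 hγ1 hκ).add
      (((tendsto_log_one_sub_mul_div 1).sub (tendsto_log_one_sub_mul_div κ)).const_mul
        (x * (consta γ * constb γ)))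
    have h3 : consta γ * κ ^ (-constb γ) + x * (consta γ * constb γ) * (-1 - -κ) =
        consta γ * (κ ^ (-constb γ) + x * constb γ * (κ - 1)) := by ring
    rw [h3] at h2
    refine h2.congr' ?_
    filter_upwards [self_mem_nhdsWithin] with s hs
    have hs0 : (0 : ℝ) < s := hs
    have h4 : s ^ (-(constb γ + 1)) * s ^ constb γ = s⁻¹ := by
      rw [← Real.rpow_add hs0, ← Real.rpow_neg_one]
      congr 1
      ring
    rw [centre, one_mul, div_eq_mul_inv, div_eq_mul_inv, ← h4]
    ring
  filter_upwards [h1.eventually (gt_mem_nhds hD), Ioo_mem_nhdsGT one_pos,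
    Ioo_mem_nhdsGT (inv_pos.2 hκ)] with s hs hs1 hsκ F hF
  have hs0 : 0 < s := hs1.1
  have hκs0 : 0 < κ * s := mul_pos hκ hs0
  have hκs1 : κ * s < 1 := by
    have := mul_lt_mul_of_pos_left hsκ.2 hκ
    rwa [mul_inv_cancel₀ hκ.ne'] at this
  set u := Real.log (1 - s) - Real.log (1 - κ * s) with hu
  have hp1 : 0 < 1 - s := by linarith [hs1.2]
  have hp2 : 0 < 1 - κ * s := by linarith
  have hterm : ∀ j ∈ F, theta γ j * (1 - s) ^ j ≤
      (theta γ j * (1 - κ * s) ^ j) * Real.exp (x * centre γ s * u) := by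
    intro j hj
    obtain ⟨hj1, hj2⟩ := hF j hj
    have h5 : (1 - s) ^ j = (1 - κ * s) ^ j * Real.exp (j * u) := by
      rw [← Real.exp_log hp1, ← Real.exp_log hp2, ← Real.exp_nat_mul, ← Real.exp_nat_mul,
        ← Real.exp_add]
      congr 1
      rw [hu]
      ring
    have h6 : (j : ℝ) * u ≤ x * centre γ s * u := by
      rcases lt_trichotomy κ 1 with hk | hk | hk
      · have hu0 : u ≤ 0 := sub_nonpos.2 (Real.log_le_log hp1 (by nlinarith))
        have : x * centre γ s - j ≤ 0 := by
          by_contra! hc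
          nlinarith
        nlinarith
      · have hu0 : u = 0 := by rw [hu, hk, one_mul, sub_self]
        rw [hu0, mul_zero, mul_zero]
      · have hu0 : 0 ≤ u := sub_nonneg.2 (Real.log_le_log hp2 (by nlinarith))
        have : 0 ≤ x * centre γ s - j := by
          by_contra! hc
          nlinarith
        nlinarith
    rw [h5, ← mul_assoc]
    have := theta_pos hγ0 hγ1 hj1
    exact mul_le_mul_of_nonneg_left (Real.exp_le_exp.2 h6) (by positivity)
  refine (Finset.sum_le_sum hterm).trans ?_
  rw [← Finset.sum_mul]
  refine (mul_le_mul_of_nonneg_right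
    (sum_le_tiltedSum hγ0 hγ1 hκs0 hκs1 fun j hj => (hF j hj).1) (Real.exp_pos _).le).trans ?_
  rw [← Real.exp_log (tiltedSum_pos hγ0 hγ1 hκs0 hκs1), ← Real.exp_add]
  refine Real.exp_le_exp.2 ?_
  have h7 : 0 < s ^ constb γ := Real.rpow_pos_of_pos hs0 _
  rw [Real.rpow_neg hs0.le, ← div_eq_mul_inv, le_div_iff₀ h7]
  exact hs.le

/-- A parameter for which the Chernoff exponent is smaller than `a`. -/
lemma exists_chernoff_param {b x : ℝ} (hb : 0 < b) (hx : x ≠ 1) :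
    ∃ κ : ℝ, 0 < κ ∧ (κ - 1) * (x - 1) < 0 ∧ κ ^ (-b) + x * b * (κ - 1) < 1 := by
  have h1 : HasDerivAt (fun κ : ℝ => κ ^ (-b) + x * b * (κ - 1)) (b * (x - 1)) 1 := by
    have h2 := (Real.hasDerivAt_rpow_const (x := 1) (p := -b) (Or.inl one_ne_zero)).add
      (((hasDerivAt_id (1 : ℝ)).sub_const 1).const_mul (x * b))
    refine h2.congr_deriv ?_
    rw [Real.one_rpow]
    ring
  have h3 := hasDerivAt_iff_tendsto_slope.1 h1
  have h4 : ∀ᶠ κ in 𝓝[≠] (1 : ℝ),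
      0 < slope (fun κ : ℝ => κ ^ (-b) + x * b * (κ - 1)) 1 κ * (x - 1) := by
    refine (h3.mul_const (x - 1)).eventually (lt_mem_nhds ?_)
    have : 0 < (x - 1) * (x - 1) := by
      rcases lt_or_gt_of_ne hx with h | h <;> nlinarith
    nlinarith
  rcases lt_or_gt_of_ne hx with h | h
  · obtain ⟨κ, hκ1, hκ2⟩ := ((h4.filter_mono (nhdsWithin_mono _
      (fun y (hy : y ∈ Set.Ioi (1 : ℝ)) => ne_of_gt hy))).and self_mem_nhdsWithin).exists
    have hκ3 : (1 : ℝ) < κ := hκ2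
    refine ⟨κ, by linarith, by nlinarith, ?_⟩
    rw [slope_def_field] at hκ1
    have h5 : (κ ^ (-b) + x * b * (κ - 1) - (1 ^ (-b) + x * b * (1 - 1))) / (κ - 1) < 0 := by
      by_contra! hc
      nlinarith
    rw [div_lt_iff₀ (by linarith), Real.one_rpow] at h5
    linarith
  · obtain ⟨κ, ⟨hκ1, hκ2⟩, hκ4⟩ := (((h4.filter_mono (nhdsWithin_mono _
      (fun y (hy : y ∈ Set.Iio (1 : ℝ)) => ne_of_lt hy))).and self_mem_nhdsWithin).and
        (mem_nhdsWithin_of_mem_nhds (Ioi_mem_nhds (zero_lt_one (α := ℝ))))).exists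
    have hκ3 : κ < (1 : ℝ) := hκ2
    refine ⟨κ, hκ4, by nlinarith, ?_⟩
    rw [slope_def_field] at hκ1
    have h5 : 0 < (κ ^ (-b) + x * b * (κ - 1) - (1 ^ (-b) + x * b * (1 - 1))) / (κ - 1) := by
      by_contra! hc
      nlinarith
    rw [lt_div_iff_of_neg (by linarith), Real.one_rpow] at h5
    linarith

/-- The terms away from the centre contribute a negligible proportion of the series. -/
lemma exists_tail_bound (hγ0 : 0 < γ) (hγ1 : γ < 1) {ε : ℝ} (hε : 0 < ε) :
    ∃ η : ℝ, 0 < η ∧ ∀ᶠ s in 𝓝[>] (0 : ℝ), ∀ F : Finset ℕ,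
      (∀ j ∈ F, 1 ≤ j ∧ ((j : ℝ) ≤ (1 - ε) * centre γ s ∨ (1 + ε) * centre γ s ≤ j)) →
      ∑ j ∈ F, theta γ j * (1 - s) ^ j ≤ 2 * Real.exp ((consta γ - η) * s ^ (-constb γ)) := by
  have ha := consta_pos hγ0 hγ1
  have hb := constb_pos hγ0 hγ1
  obtain ⟨κ₁, h1, h2, h3⟩ := exists_chernoff_param hb (show 1 - ε ≠ 1 by linarith)
  obtain ⟨κ₂, g1, g2, g3⟩ := exists_chernoff_param hb (show 1 + ε ≠ 1 by linarith)
  have h4 := mul_lt_mul_of_pos_left h3 ha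
  have g4 := mul_lt_mul_of_pos_left g3 ha
  rw [mul_one] at h4 g4
  obtain ⟨D, hD1, hD2⟩ := exists_between (max_lt h4 g4)
  have hD3 := (le_max_left _ _).trans_lt hD1
  have hD4 := (le_max_right _ _).trans_lt hD1
  refine ⟨consta γ - D, by linarith, ?_⟩
  filter_upwards [eventually_sum_le_exp hγ0 hγ1 h1 hD3, eventually_sum_le_exp hγ0 hγ1 g1 hD4]
    with s e1 e2 F hF
  rw [sub_sub_cancel]
  have hκ₁ : 0 < κ₁ - 1 := by
    by_contra! hc
    nlinarith
  have hκ₂ : κ₂ - 1 < 0 := by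
    by_contra! hc
    nlinarith
  have f1 := e1 (F.filter fun j => (j : ℝ) ≤ (1 - ε) * centre γ s) fun j hj => by
    rw [Finset.mem_filter] at hj
    exact ⟨(hF j hj.1).1, mul_nonneg hκ₁.le (sub_nonneg.2 hj.2)⟩
  have f2 := e2 (F.filter fun j => ¬ (j : ℝ) ≤ (1 - ε) * centre γ s) fun j hj => by
    rw [Finset.mem_filter] at hj
    exact ⟨(hF j hj.1).1, mul_nonneg_of_nonpos_of_nonpos hκ₂.le
      (sub_nonpos.2 ((hF j hj.1).2.resolve_left hj.2))⟩
  rw [← Finset.sum_filter_add_sum_filter_not F (fun j => (j : ℝ) ≤ (1 - ε) * centre γ s)]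
  linarith

/-- The terms beyond a large multiple of the centre have a small sum, not merely a small share of
the series. -/
lemma eventually_far_tail_le (hγ0 : 0 < γ) (hγ1 : γ < 1) {K : ℝ}
    (hK : 2 ^ (constb γ + 1) / constb γ < K) :
    ∀ᶠ s in 𝓝[>] (0 : ℝ), ∀ F : Finset ℕ,
      (∀ j ∈ F, 1 ≤ j ∧ K * centre γ s ≤ j) → ∑ j ∈ F, theta γ j * (1 - s) ^ j ≤ 1 / 2 := by
  have ha := consta_pos hγ0 hγ1
  have hb := constb_pos hγ0 hγ1
  have h1 : consta γ * ((1 / 2 : ℝ) ^ (-constb γ) + K * constb γ * (1 / 2 - 1)) < 0 := by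
    rw [div_lt_iff₀ hb, Real.rpow_add two_pos, Real.rpow_one] at hK
    have h2 : (1 / 2 : ℝ) ^ (-constb γ) = 2 ^ constb γ := by
      rw [one_div, Real.inv_rpow zero_le_two, Real.rpow_neg zero_le_two, inv_inv]
    rw [h2]
    exact mul_neg_of_pos_of_neg ha (by linarith)
  obtain ⟨D, hD1, hD2⟩ := exists_between h1
  have h3 : Tendsto (fun s : ℝ => D * s ^ (-constb γ)) (𝓝[>] 0) atBot :=
    (tendsto_rpow_neg_nhdsGT_zero hb).const_mul_atTop_of_neg hD2
  have h4 := Real.tendsto_exp_atBot.comp h3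
  filter_upwards [eventually_sum_le_exp hγ0 hγ1 one_half_pos hD1,
    h4.eventually (gt_mem_nhds one_half_pos)] with s e1 e2 F hF
  refine (e1 F fun j hj => ⟨(hF j hj).1, ?_⟩).trans e2.le
  have := (hF j hj).2
  nlinarith

end tilted

/-! ### Growth of a single weight -/

section growth

variable {γ : ℝ}

lemma consta_mul_constb (hγ1 : γ < 1) : consta γ * constb γ = γ * γ ^ constb γ := by
  have : (1 - γ) ≠ 0 := (sub_pos.2 hγ1).ne'
  rw [consta, ← constb, constb]
  field_simp

lemma constb_add_one_mul (hγ1 : γ < 1) : (constb γ + 1) * γ = constb γ := by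
  have : (1 - γ) ≠ 0 := (sub_pos.2 hγ1).ne'
  rw [constb]
  field_simp
  ring

lemma centre_pos (hγ0 : 0 < γ) (hγ1 : γ < 1) {s : ℝ} (hs : 0 < s) : 0 < centre γ s := by
  have := consta_pos hγ0 hγ1
  have := constb_pos hγ0 hγ1
  have := Real.rpow_pos_of_pos hs (-(constb γ + 1))
  rw [centre]
  positivity

lemma centre_mul {s : ℝ} (hs : 0 < s) :
    centre γ s * s = consta γ * constb γ * s ^ (-constb γ) := by
  rw [centre, mul_assoc, ← Real.rpow_add_one hs.ne']
  congr 2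
  ring

lemma centre_rpow (hγ0 : 0 < γ) (hγ1 : γ < 1) {s : ℝ} (hs : 0 < s) :
    centre γ s ^ γ = γ ^ constb γ * s ^ (-constb γ) := by
  have hab : 0 < consta γ * constb γ := mul_pos (consta_pos hγ0 hγ1) (constb_pos hγ0 hγ1)
  have h1 : consta γ * constb γ = γ ^ (constb γ + 1) := by
    rw [consta_mul_constb hγ1, Real.rpow_add_one hγ0.ne', mul_comm]
  rw [centre, Real.mul_rpow hab.le (Real.rpow_pos_of_pos hs _).le, h1, ← Real.rpow_mul hγ0.le,
    ← Real.rpow_mul hs.le, constb_add_one_mul hγ1, neg_mul, constb_add_one_mul hγ1]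

lemma tendsto_centre (hγ0 : 0 < γ) (hγ1 : γ < 1) : Tendsto (centre γ) (𝓝[>] 0) atTop := by
  have hb := constb_pos hγ0 hγ1
  exact (tendsto_rpow_neg_nhdsGT_zero (show 0 < constb γ + 1 by linarith)).const_mul_atTop
    (mul_pos (consta_pos hγ0 hγ1) hb)

lemma tendsto_log_centre (hγ0 : 0 < γ) (hγ1 : γ < 1) :
    Tendsto (fun s => Real.log (centre γ s) * s ^ constb γ) (𝓝[>] 0) (𝓝 0) := by
  have hb := constb_pos hγ0 hγ1
  have hab : 0 < consta γ * constb γ := mul_pos (consta_pos hγ0 hγ1) hb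
  have h1 := ((tendsto_rpow_nhdsGT_zero hb).const_mul (Real.log (consta γ * constb γ))).sub
    ((tendsto_log_mul_rpow_nhdsGT_zero hb).const_mul (constb γ + 1))
  simp only [mul_zero, sub_zero] at h1
  refine h1.congr' ?_
  filter_upwards [self_mem_nhdsWithin] with s hs
  rw [centre, Real.log_mul hab.ne' (Real.rpow_pos_of_pos hs _).ne', Real.log_rpow hs]
  ring

lemma tiltedSum_le (hγ0 : 0 < γ) (hγ1 : γ < 1) {s B : ℝ} (hs0 : 0 < s) (hs1 : s < 1)
    (hB : ∀ F : Finset ℕ, (∀ j ∈ F, 1 ≤ j) → ∑ j ∈ F, theta γ j * (1 - s) ^ j ≤ B) :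
    tiltedSum γ s ≤ B := by
  refine hasSum_le_of_sum_le (hasSum_tiltedSum hγ0 hγ1 hs0 hs1) fun F => ?_
  have := hB (F.image fun i => i + 1) fun j hj => by
    obtain ⟨i, _, rfl⟩ := Finset.mem_image.1 hj
    omega
  rwa [Finset.sum_image fun i _ j _ hij => by simpa using hij] at this

/-- Lower bound for `log θⱼ` when `j` lies slightly above the centre: more than half of the series
comes from the terms near the centre, each of which is at most `θⱼ` times a power of `1 - s`. -/
lemma eventually_log_theta_centre (hγ0 : 0 < γ) (hγ1 : γ < 1) {δ : ℝ} (hδ : 0 < δ)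
    (hδ1 : δ ≤ 1 / 4) :
    ∀ᶠ s in 𝓝[>] (0 : ℝ), ∀ J : ℕ, (J : ℝ) = (1 + δ) * centre γ s →
      (1 - 4 * δ) * (J : ℝ) ^ γ ≤ Real.log (theta γ J) := by
  have hb := constb_pos hγ0 hγ1
  have hw : 0 < γ ^ constb γ := Real.rpow_pos_of_pos hγ0 _
  obtain ⟨η, hη, htail⟩ := exists_tail_bound hγ0 hγ1 hδ
  have hlog := tendsto_log_tiltedSum hγ0 hγ1
  have hp := tendsto_rpow_nhdsGT_zero hb
  have h1 := (hlog.sub (hp.const_mul (Real.log 4)))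
  rw [mul_zero, sub_zero] at h1
  have h2 := (hlog.sub (hp.const_mul (Real.log 2 + Real.log (1 + δ)))).sub
    (tendsto_log_centre hγ0 hγ1)
  rw [mul_zero, sub_zero, sub_zero] at h2
  filter_upwards [htail, h1.eventually (lt_mem_nhds (show consta γ - η < consta γ by linarith)),
    h2.eventually (lt_mem_nhds (show consta γ - 2 * δ * γ ^ constb γ < consta γ by
      have := mul_pos hδ hw; linarith)),
    Ioo_mem_nhdsGT one_pos] with s htail e1 e2 hs J hJ
  have hs0 : 0 < s := hs.1
  have hs1 : s < 1 := hs.2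
  have hp1 : 0 < 1 - s := by linarith
  have hc := centre_pos hγ0 hγ1 hs0
  have hΛ := tiltedSum_pos hγ0 hγ1 hs0 hs1
  have hT : 0 < s ^ (-constb γ) := Real.rpow_pos_of_pos hs0 _
  have hTT : s ^ constb γ * s ^ (-constb γ) = 1 := by
    rw [← Real.rpow_add hs0]; simp
  have hJ0 : 0 < (J : ℝ) := by rw [hJ]; positivity
  have hJ1 : 1 ≤ J := by exact_mod_cast hJ0
  have hθJ := theta_pos hγ0 hγ1 hJ1
  have hbound : tiltedSum γ s ≤ 2 * Real.exp ((consta γ - η) * s ^ (-constb γ)) +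
      J * (theta γ J * Real.exp (-((1 - δ) * centre γ s * s))) := by
    refine tiltedSum_le hγ0 hγ1 hs0 hs1 fun F hF => ?_
    rw [← Finset.sum_filter_add_sum_filter_not F
      (fun j => (j : ℝ) ≤ (1 - δ) * centre γ s ∨ (1 + δ) * centre γ s ≤ j)]
    refine add_le_add (htail _ fun j hj => ?_) ?_
    · exact ⟨hF j (Finset.mem_filter.1 hj).1, (Finset.mem_filter.1 hj).2⟩
    · have hsub : (F.filter fun j : ℕ =>
          ¬ ((j : ℝ) ≤ (1 - δ) * centre γ s ∨ (1 + δ) * centre γ s ≤ j)) ⊆ Finset.Icc 1 J := by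
        intro j hj
        rw [Finset.mem_filter] at hj
        push Not at hj
        refine Finset.mem_Icc.2 ⟨hF j hj.1, ?_⟩
        have : (j : ℝ) ≤ J := by rw [hJ]; exact hj.2.2.le
        exact_mod_cast this
      have hcard : ((F.filter fun j : ℕ =>
          ¬ ((j : ℝ) ≤ (1 - δ) * centre γ s ∨ (1 + δ) * centre γ s ≤ j)).card : ℝ) ≤ J := by
        have := Finset.card_le_card hsub
        rw [Nat.card_Icc, Nat.add_sub_cancel] at this
        exact_mod_cast this
      have hM : 0 ≤ theta γ J * Real.exp (-((1 - δ) * centre γ s * s)) := by positivity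
      refine (Finset.sum_le_card_nsmul _ _ _ fun j hj => ?_).trans
        (by rw [nsmul_eq_mul]; exact mul_le_mul_of_nonneg_right hcard hM)
      have hj1 := Finset.mem_Icc.1 (hsub hj)
      have hj2 := (Finset.mem_filter.1 hj).2
      push Not at hj2
      have hmono : theta γ j ≤ theta γ J := by
        have := monotone_theta hγ0 hγ1 (show j - 1 ≤ J - 1 by omega)
        simp only at this
        rwa [Nat.sub_add_cancel hj1.1, Nat.sub_add_cancel hJ1] at this
      refine mul_le_mul hmono ?_ (by positivity) hθJ.le
      calc (1 - s) ^ j ≤ Real.exp (-s) ^ j :=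
            pow_le_pow_left₀ hp1.le (Real.one_sub_le_exp_neg s) j
        _ = Real.exp (-(j * s)) := by rw [← Real.exp_nat_mul]; congr 1; ring
        _ ≤ _ := by
            refine Real.exp_le_exp.2 (neg_le_neg ?_)
            exact mul_le_mul_of_nonneg_right hj2.1.le hs0.le
  have hhalf : 2 * Real.exp ((consta γ - η) * s ^ (-constb γ)) ≤ tiltedSum γ s / 2 := by
    have e1' := mul_lt_mul_of_pos_right e1 hT
    have h3 : (Real.log (tiltedSum γ s) * s ^ constb γ - Real.log 4 * s ^ constb γ) *
        s ^ (-constb γ) = Real.log (tiltedSum γ s) - Real.log 4 := by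
      linear_combination (Real.log (tiltedSum γ s) - Real.log 4) * hTT
    rw [h3] at e1'
    have h4 := Real.exp_le_exp.2 e1'.le
    rw [Real.exp_sub, Real.exp_log hΛ, Real.exp_log (by norm_num)] at h4
    linarith
  have hkey : tiltedSum γ s / 2 ≤ J * (theta γ J * Real.exp (-((1 - δ) * centre γ s * s))) := by
    linarith
  have hkey2 := Real.log_le_log (by positivity) hkey
  rw [Real.log_div hΛ.ne' two_ne_zero, Real.log_mul hJ0.ne' (by positivity),
    Real.log_mul hθJ.ne' (Real.exp_pos _).ne', Real.log_exp, hJ,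
    Real.log_mul (by positivity) hc.ne', mul_assoc (1 - δ), centre_mul hs0,
    consta_mul_constb hγ1] at hkey2
  have e2' := mul_lt_mul_of_pos_right e2 hT
  have h5 : (Real.log (tiltedSum γ s) * s ^ constb γ -
      (Real.log 2 + Real.log (1 + δ)) * s ^ constb γ - Real.log (centre γ s) * s ^ constb γ) *
      s ^ (-constb γ) = Real.log (tiltedSum γ s) - Real.log 2 - Real.log (1 + δ) -
        Real.log (centre γ s) := by
    linear_combination (Real.log (tiltedSum γ s) - Real.log 2 - Real.log (1 + δ) -
        Real.log (centre γ s)) * hTT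
  rw [h5] at e2'
  have ha : consta γ = (1 - γ) * γ ^ constb γ := rfl
  rw [ha] at e2'
  have hpow : (1 + δ) ^ γ ≤ 1 + δ := by
    calc (1 + δ) ^ γ ≤ (1 + δ) ^ (1 : ℝ) :=
          Real.rpow_le_rpow_of_exponent_le (by linarith) hγ1.le
      _ = 1 + δ := Real.rpow_one _
  rw [hJ, Real.mul_rpow (by linarith) hc.le, centre_rpow hγ0 hγ1 hs0]
  have hwT : 0 < γ ^ constb γ * s ^ (-constb γ) := mul_pos hw hT
  have h6 : (1 - 4 * δ) * ((1 + δ) ^ γ * (γ ^ constb γ * s ^ (-constb γ))) ≤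
      (1 - 3 * δ) * (γ ^ constb γ * s ^ (-constb γ)) := by
    rw [← mul_assoc]
    refine mul_le_mul_of_nonneg_right ?_ hwT.le
    have := mul_le_mul_of_nonneg_left hpow (show 0 ≤ 1 - 4 * δ by linarith)
    nlinarith
  have h7 : δ * γ * (γ ^ constb γ * s ^ (-constb γ)) ≤ δ * (γ ^ constb γ * s ^ (-constb γ)) :=
    mul_le_mul_of_nonneg_right (by nlinarith) hwT.le
  linarith

/-- The weights grow at least like `exp (j ^ γ)` on the logarithmic scale. -/
lemma eventually_log_theta (hγ0 : 0 < γ) (hγ1 : γ < 1) {ε : ℝ} (hε : 0 < ε) (hε1 : ε ≤ 1) :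
    ∀ᶠ J : ℕ in atTop, (1 - ε) * (J : ℝ) ^ γ ≤ Real.log (theta γ J) := by
  have hb := constb_pos hγ0 hγ1
  have hab : 0 < consta γ * constb γ := mul_pos (consta_pos hγ0 hγ1) hb
  set δ := ε / 4 with hδ
  -- the parameter whose centre is `J / (1 + δ)`
  set u : ℕ → ℝ := fun J => ((1 + δ) * (consta γ * constb γ) * (1 / (J : ℝ))) ^
    (1 / (constb γ + 1)) with hu
  have h1 : Tendsto u atTop (𝓝[>] 0) := by
    refine tendsto_nhdsWithin_iff.2 ⟨?_, ?_⟩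
    · have h2 : Tendsto (fun J : ℕ => (1 + δ) * (consta γ * constb γ) * (1 / (J : ℝ))) atTop
          (𝓝 0) := by
        have := (tendsto_one_div_atTop_nhds_zero_nat (𝕜 := ℝ)).const_mul
          ((1 + δ) * (consta γ * constb γ))
        rwa [mul_zero] at this
      have h3 : 0 < 1 / (constb γ + 1) := by positivity
      have h4 := (Real.continuousAt_rpow_const 0 (1 / (constb γ + 1)) (Or.inr h3.le)).tendsto.comp h2
      rwa [Real.zero_rpow h3.ne'] at h4
    · filter_upwards [eventually_gt_atTop 0] with J hJ
      have : (0 : ℝ) < J := by exact_mod_cast hJ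
      exact Real.rpow_pos_of_pos (by positivity) _
  filter_upwards [h1.eventually (eventually_log_theta_centre hγ0 hγ1 (δ := δ) (by positivity)
    (by linarith)), eventually_gt_atTop 0] with J hJ hJ0
  have hJ0' : (0 : ℝ) < J := by exact_mod_cast hJ0
  have h2 := hJ J ?_
  · have h3 : 1 - 4 * δ = 1 - ε := by rw [hδ]; ring
    rwa [h3] at h2
  · have hx : 0 < (1 + δ) * (consta γ * constb γ) * (1 / (J : ℝ)) := by positivity
    have hne : constb γ + 1 ≠ 0 := by linarith
    rw [centre, hu]
    simp only
    rw [← Real.rpow_mul hx.le, mul_neg, one_div_mul_cancel hne, Real.rpow_neg_one]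
    have hd : 1 + δ ≠ 0 := by positivity
    have ha := (consta_pos hγ0 hγ1).ne'
    field_simp

lemma one_add_rpow_sub_le {γ u : ℝ} (hγ0 : 0 < γ) (hγ1 : γ < 1) (hu : 0 ≤ u) :
    1 - γ - u ^ 2 ≤ (1 + u) ^ γ - γ * (1 + u) := by
  have h1 : (1 + u) ^ (1 - γ) ≤ 1 + (1 - γ) * u :=
    rpow_one_add_le_one_add_mul_self (by linarith) (by linarith) (by linarith)
  have h2 : (1 + u) ^ γ * (1 + u) ^ (1 - γ) = 1 + u := by
    rw [← Real.rpow_add (by linarith)]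
    simp
  have h3 : 0 < (1 + u) ^ γ := Real.rpow_pos_of_pos (by linarith) _
  have h4 := mul_le_mul_of_nonneg_left h1 h3.le
  rw [h2] at h4
  have h5 : (1 + u) * (1 - (1 - γ) * u) ≤ (1 + u) ^ γ := by
    by_contra! hc
    have h6 : 0 < 1 + (1 - γ) * u := by nlinarith
    have h7 := mul_lt_mul_of_pos_right hc h6
    have h8 : (1 + u) * (1 - (1 - γ) * u) * (1 + (1 - γ) * u) =
      (1 + u) - (1 + u) * ((1 - γ) * u) ^ 2 := by ring
    have h9 : 0 ≤ (1 + u) * ((1 - γ) * u) ^ 2 := by positivity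
    linarith
  nlinarith [mul_nonneg hγ0.le (sq_nonneg u)]

/-- Near the centre, at relative distance `δ`, each single term of the series is as large as its
sum up to a factor `exp (O (δ²) s ^ (-b))`: the exponent `j ^ γ - s j` is stationary there. -/
lemma eventually_le_term (hγ0 : 0 < γ) (hγ1 : γ < 1) {δ : ℝ} (hδ : 0 < δ) (hδ1 : δ ≤ 1) :
    ∀ᶠ s in 𝓝[>] (0 : ℝ), ∀ j : ℕ, centre γ s ≤ j → (j : ℝ) ≤ (1 + δ) * centre γ s →
      Real.exp ((consta γ - 5 * δ ^ 2) * s ^ (-constb γ)) ≤ theta γ j * (1 - s) ^ j := by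
  have hw : 0 < γ ^ constb γ := Real.rpow_pos_of_pos hγ0 _
  have hw1 : γ ^ constb γ ≤ 1 := Real.rpow_le_one hγ0.le hγ1.le (constb_pos hγ0 hγ1).le
  have hδ2 : 0 < δ ^ 2 := by positivity
  have hδ3 : δ ^ 2 ≤ 1 := by nlinarith
  obtain ⟨J₀, hJ₀⟩ := eventually_atTop.1 (eventually_log_theta hγ0 hγ1 hδ2 hδ3)
  filter_upwards [(tendsto_centre hγ0 hγ1).eventually (eventually_ge_atTop (J₀ : ℝ)),
    (tendsto_log_one_sub_mul_div 1).eventually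
      (lt_mem_nhds (show -(1 + δ ^ 2) < -1 by linarith)), Ioo_mem_nhdsGT one_pos]
    with s e1 e2 hs j hj1 hj2
  have hs0 : 0 < s := hs.1
  have hp1 : 0 < 1 - s := by linarith [hs.2]
  have hc := centre_pos hγ0 hγ1 hs0
  have hj0 : (0 : ℝ) < j := hc.trans_le hj1
  have hj : 1 ≤ j := by exact_mod_cast hj0
  have hθ := theta_pos hγ0 hγ1 hj
  have hT : 0 < s ^ (-constb γ) := Real.rpow_pos_of_pos hs0 _
  rw [one_mul, lt_div_iff₀ hs0] at e2
  have hlogθ := hJ₀ j (by exact_mod_cast e1.trans hj1)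
  obtain ⟨u, hu⟩ : ∃ u : ℝ, (j : ℝ) = (1 + u) * centre γ s := ⟨j / centre γ s - 1, by
    field_simp; ring⟩
  have hu0 : 0 ≤ u := by
    rw [hu] at hj1
    by_contra! hcon
    nlinarith
  have hu1 : u ≤ δ := by
    rw [hu] at hj2
    have := le_of_mul_le_mul_right hj2 hc
    linarith
  have hjγ : (j : ℝ) ^ γ = (1 + u) ^ γ * (γ ^ constb γ * s ^ (-constb γ)) := by
    rw [hu, Real.mul_rpow (by linarith) hc.le, centre_rpow hγ0 hγ1 hs0]
  have hjs : (j : ℝ) * s = γ * (1 + u) * (γ ^ constb γ * s ^ (-constb γ)) := by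
    rw [hu, mul_assoc, centre_mul hs0, consta_mul_constb hγ1]
    ring
  have hlog1 : -((1 + δ ^ 2) * (j * s)) ≤ j * Real.log (1 - s) := by
    have := mul_le_mul_of_nonneg_left e2.le hj0.le
    linarith
  rw [← Real.exp_log (mul_pos hθ (pow_pos hp1 j)), Real.log_mul hθ.ne' (pow_pos hp1 j).ne',
    Real.log_pow]
  refine Real.exp_le_exp.2 ?_
  rw [hjγ] at hlogθ
  rw [hjs] at hlog1
  have ha : consta γ = (1 - γ) * γ ^ constb γ := rfl
  have hwT : 0 < γ ^ constb γ * s ^ (-constb γ) := mul_pos hw hT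
  have h1 := one_add_rpow_sub_le hγ0 hγ1 hu0
  have h2 : (1 + u) ^ γ ≤ 2 := by
    calc (1 + u) ^ γ ≤ (1 + u) ^ (1 : ℝ) :=
          Real.rpow_le_rpow_of_exponent_le (by linarith) hγ1.le
      _ ≤ 2 := by rw [Real.rpow_one]; linarith
  have h3 : γ * (1 + u) ≤ 2 := by nlinarith
  have h4 : u ^ 2 ≤ δ ^ 2 := by nlinarith
  have h5 : (1 - γ) - 5 * δ ^ 2 ≤ (1 - δ ^ 2) * (1 + u) ^ γ - (1 + δ ^ 2) * (γ * (1 + u)) := by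
    nlinarith
  have h6 := mul_le_mul_of_nonneg_right h5 hwT.le
  have h7 : 5 * δ ^ 2 * (γ ^ constb γ * s ^ (-constb γ)) ≤ 5 * δ ^ 2 * s ^ (-constb γ) := by
    refine mul_le_mul_of_nonneg_left ?_ (by positivity)
    nlinarith
  rw [ha]
  linarith

end growth

/-! ### A renewal comparison principle -/

section renewal

variable {N X lo hi : ℕ} {q v : ℕ → ℝ} {β : ℝ}

lemma renewal_ge (hv : ∀ i, 0 ≤ v i) (hq : ∀ j, 1 ≤ j → 0 ≤ q j)
    (hrec : ∀ k : ℕ, (k : ℝ) * v k = N * ∑ j ∈ Finset.Icc 1 k, q j * v (k - j))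
    {k : ℕ} (hk : 1 ≤ k) (hkN : k ≤ N) :
    ∑ j ∈ Finset.Icc 1 k, q j * v (k - j) ≤ v k := by
  have hk0 : (0 : ℝ) < k := by exact_mod_cast hk
  have hkN' : (k : ℝ) ≤ N := by exact_mod_cast hkN
  have hS : 0 ≤ ∑ j ∈ Finset.Icc 1 k, q j * v (k - j) :=
    Finset.sum_nonneg fun j hj => mul_nonneg (hq j (Finset.mem_Icc.1 hj).1) (hv _)
  refine le_of_mul_le_mul_left ?_ hk0
  rw [hrec k]
  exact mul_le_mul_of_nonneg_right hkN' hS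

/-- Following `m` jumps with lengths between `lo` and `hi`. -/
lemma renewal_jump (hv : ∀ i, 0 ≤ v i) (hq : ∀ j, 1 ≤ j → 0 ≤ q j)
    (hrec : ∀ k : ℕ, (k : ℝ) * v k = N * ∑ j ∈ Finset.Icc 1 k, q j * v (k - j))
    (hβ0 : 0 ≤ β) (hβ : ∀ j, lo ≤ j → j ≤ hi → β ≤ q j) (hlo : 1 ≤ lo) (i : ℕ) (m : ℕ) :
    ∀ d, m * lo ≤ d → d ≤ m * hi → i + d ≤ N → β ^ m * v i ≤ v (i + d) := by
  induction m with
  | zero =>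
    intro d _ hd _
    obtain rfl : d = 0 := by simpa using hd
    simp
  | succ m ih =>
    intro d h1 h2 h3
    rw [Nat.succ_mul] at h1 h2
    obtain ⟨j, hj1, hj2, hj3, hj4, hjd⟩ : ∃ j, lo ≤ j ∧ j ≤ hi ∧ m * lo ≤ d - j ∧
        d - j ≤ m * hi ∧ j ≤ d := by
      rcases le_total lo (d - m * hi) with h | h
      · have hlohi : m * lo ≤ m * hi := by
          have : lo ≤ hi := by omega
          exact Nat.mul_le_mul_left m this
        exact ⟨d - m * hi, h, by omega, by omega, by omega, by omega⟩
      · rcases Nat.eq_zero_or_pos m with rfl | hm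
        · refine ⟨lo, le_rfl, ?_, by omega, by omega, by omega⟩
          omega
        · by_cases hlohi : lo ≤ hi
          · exact ⟨lo, le_rfl, hlohi, by omega, by omega, by omega⟩
          · have : m * hi ≤ m * lo := Nat.mul_le_mul_left m (by omega)
            omega
    have h4 := ih (d - j) hj3 hj4 (by omega)
    have h5 := renewal_ge hv hq hrec (k := i + d) (by omega) h3
    have h6 : q j * v (i + d - j) ≤ ∑ j ∈ Finset.Icc 1 (i + d), q j * v (i + d - j) :=
      Finset.single_le_sum (f := fun j => q j * v (i + d - j))
        (fun l hl => mul_nonneg (hq l (Finset.mem_Icc.1 hl).1) (hv _))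
        (Finset.mem_Icc.2 ⟨by omega, by omega⟩)
    have h7 : i + d - j = i + (d - j) := by omega
    rw [h7] at h6
    calc β ^ (m + 1) * v i = β * (β ^ m * v i) := by ring
      _ ≤ q j * v (i + (d - j)) :=
          mul_le_mul (hβ j hj1 hj2) h4 (mul_nonneg (pow_nonneg hβ0 m) (hv i)) (hq j (by omega))
      _ ≤ _ := h6.trans h5

/-- Minimum principle: a lower bound on a window longer than the effective range of the jumps
propagates up to `N`. -/
lemma renewal_min (hv : ∀ i, 0 ≤ v i) (hq : ∀ j, 1 ≤ j → 0 ≤ q j)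
    (hrec : ∀ k : ℕ, (k : ℝ) * v k = N * ∑ j ∈ Finset.Icc 1 k, q j * v (k - j))
    {τ μ : ℝ} (hτ0 : 0 ≤ τ) (hτ1 : τ ≤ 1) (hμ : 0 ≤ μ)
    (hqX : 1 - τ ≤ ∑ j ∈ Finset.Icc 1 X, q j) {i : ℕ}
    (hwin : ∀ d, X ≤ d → d ≤ 2 * X → i + d ≤ N → μ ≤ v (i + d)) (k : ℕ) :
    i + X ≤ k → k ≤ N → (1 - τ) ^ k * μ ≤ v k := by
  have h10 : 0 ≤ 1 - τ := by linarith
  have h11 : 1 - τ ≤ 1 := by linarith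
  induction k using Nat.strong_induction_on with
  | _ k ih =>
    intro hk hkN
    by_cases hk2 : k ≤ i + 2 * X
    · have h1 := hwin (k - i) (by omega) (by omega) (by omega)
      rw [Nat.add_sub_cancel' (by omega)] at h1
      exact (mul_le_of_le_one_left hμ (pow_le_one₀ h10 h11)).trans h1
    · have h1 := renewal_ge hv hq hrec (k := k) (by omega) hkN
      have h2 : ∑ j ∈ Finset.Icc 1 X, q j * v (k - j) ≤
          ∑ j ∈ Finset.Icc 1 k, q j * v (k - j) :=
        Finset.sum_le_sum_of_subset_of_nonneg (Finset.Icc_subset_Icc le_rfl (by omega))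
          fun j hj _ => mul_nonneg (hq j (Finset.mem_Icc.1 hj).1) (hv _)
      have h3 : ∑ j ∈ Finset.Icc 1 X, q j * ((1 - τ) ^ (k - 1) * μ) ≤
          ∑ j ∈ Finset.Icc 1 X, q j * v (k - j) := by
        refine Finset.sum_le_sum fun j hj => ?_
        obtain ⟨hj1, hjX⟩ := Finset.mem_Icc.1 hj
        refine mul_le_mul_of_nonneg_left ?_ (hq j hj1)
        refine le_trans ?_ (ih (k - j) (by omega) (by omega) (by omega))
        exact mul_le_mul_of_nonneg_right (pow_le_pow_of_le_one h10 h11 (by omega)) hμ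
      rw [← Finset.sum_mul] at h3
      have h4 := mul_le_mul_of_nonneg_right hqX
        (mul_nonneg (pow_nonneg h10 (k - 1)) hμ)
      have h5 : (1 - τ) ^ k = (1 - τ) * (1 - τ) ^ (k - 1) := by
        rw [← pow_succ', Nat.sub_add_cancel (by omega)]
      rw [h5, mul_assoc]
      linarith

/-- Maximum principle: an upper bound up to `N - X` extends to `N` with a factor
`(1 - X / N) ^ (-X)`. -/
lemma renewal_max (hv : ∀ i, 0 ≤ v i) (hq : ∀ j, 1 ≤ j → 0 ≤ q j)
    (hrec : ∀ k : ℕ, (k : ℝ) * v k = N * ∑ j ∈ Finset.Icc 1 k, q j * v (k - j))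
    (hq1 : ∀ k, ∑ j ∈ Finset.Icc 1 k, q j ≤ 1) (hN : 1 ≤ N) (hXN : X ≤ N) {M : ℝ}
    (hM : ∀ i, i + X ≤ N → v i ≤ M) (k : ℕ) :
    k ≤ N → (1 - (X : ℝ) / N) ^ (k + X - N) * v k ≤ M := by
  have hN0 : (0 : ℝ) < N := by exact_mod_cast hN
  have hσ0 : 0 ≤ 1 - (X : ℝ) / N := by
    rw [sub_nonneg, div_le_one hN0]
    exact_mod_cast hXN
  have hσ1 : 1 - (X : ℝ) / N ≤ 1 := by
    have : 0 ≤ (X : ℝ) / N := by positivity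
    linarith
  have hM0 : 0 ≤ M := (hv 0).trans (hM 0 (by omega))
  induction k using Nat.strong_induction_on with
  | _ k ih =>
    intro hkN
    by_cases hk : k + X ≤ N
    · rw [Nat.sub_eq_zero_of_le hk, pow_zero, one_mul]
      exact hM k hk
    · have hk' : 1 ≤ k := by omega
      set σ := 1 - (X : ℝ) / N with hσ
      have h1 : σ * v k ≤ ∑ j ∈ Finset.Icc 1 k, q j * v (k - j) := by
        refine le_of_mul_le_mul_left ?_ hN0
        rw [← hrec k, ← mul_assoc]
        refine mul_le_mul_of_nonneg_right ?_ (hv k)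
        have h2 : (N : ℝ) * σ = N - X := by rw [hσ]; field_simp
        rw [h2, sub_le_iff_le_add]
        exact_mod_cast (by omega : N ≤ k + X)
      have h3 : σ ^ (k + X - N) = σ ^ (k + X - N - 1) * σ := by
        rw [← pow_succ, Nat.sub_add_cancel (by omega)]
      rw [h3, mul_assoc]
      refine (mul_le_mul_of_nonneg_left h1 (pow_nonneg hσ0 _)).trans ?_
      rw [Finset.mul_sum]
      have h4 : ∑ j ∈ Finset.Icc 1 k, σ ^ (k + X - N - 1) * (q j * v (k - j)) ≤
          ∑ j ∈ Finset.Icc 1 k, q j * M := by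
        refine Finset.sum_le_sum fun j hj => ?_
        obtain ⟨hj1, hjk⟩ := Finset.mem_Icc.1 hj
        rw [mul_left_comm]
        refine mul_le_mul_of_nonneg_left ?_ (hq j hj1)
        refine le_trans ?_ (ih (k - j) (by omega) (by omega))
        exact mul_le_mul_of_nonneg_right (pow_le_pow_of_le_one hσ0 hσ1 (by omega)) (hv _)
      rw [← Finset.sum_mul] at h4
      exact h4.trans (mul_le_of_le_one_left hM0 (hq1 k))

/-- **Comparison principle for a slowly varying renewal equation.** Suppose
`k vₖ = N ∑ⱼ qⱼ vₖ₋ⱼ`, where `q` is a sub-probability on the positive integers which is almost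
carried by `{1, …, X}` and has mass at least `β` at every point of an interval whose multiples cover
`{X, X + 1, …}`. Then no value of `v` before `N` exceeds `v N` by much. -/
lemma renewal_comparison (hv : ∀ i, 0 ≤ v i) (hq : ∀ j, 1 ≤ j → 0 ≤ q j)
    (hrec : ∀ k : ℕ, (k : ℝ) * v k = N * ∑ j ∈ Finset.Icc 1 k, q j * v (k - j))
    (hq1 : ∀ k, ∑ j ∈ Finset.Icc 1 k, q j ≤ 1)
    (hqX : 1 - 1 / (2 * (N : ℝ)) ≤ ∑ j ∈ Finset.Icc 1 X, q j)
    (hβ0 : 0 < β) (hβ1 : β ≤ 1) (hβ : ∀ j, lo ≤ j → j ≤ hi → β ≤ q j) (hlo : 1 ≤ lo)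
    (hcover : ∀ d, X ≤ d → d ≤ d / lo * hi) (hX : 2 * X ^ 2 ≤ N) (hX1 : 1 ≤ X)
    {i : ℕ} (hi : i ≤ N) : β ^ (2 * X / lo) * v i ≤ 4 * v N := by
  have hXX : X ≤ X ^ 2 := Nat.le_self_pow two_ne_zero X
  have hXN : X ≤ N := by omega
  have hN : 1 ≤ N := by omega
  have hN0 : (0 : ℝ) < N := by exact_mod_cast hN
  have hN1 : (1 : ℝ) ≤ N := by exact_mod_cast hN
  set B := β ^ (2 * X / lo) with hB
  have hB0 : 0 < B := pow_pos hβ0 _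
  have hfar : ∀ i, i + X ≤ N → v i ≤ 2 * v N / B := by
    intro i hi
    have hτ0 : 0 ≤ 1 / (2 * (N : ℝ)) := by positivity
    have hτ1 : 1 / (2 * (N : ℝ)) ≤ 1 := by
      rw [div_le_one (by positivity)]
      linarith
    have h1 := renewal_min hv hq hrec hτ0 hτ1 (mul_nonneg hB0.le (hv i)) hqX (i := i) ?_ N hi le_rfl
    · have h2 := one_add_mul_le_pow (a := -(1 / (2 * (N : ℝ)))) (by linarith) N
      have h3 : 1 + (N : ℝ) * -(1 / (2 * (N : ℝ))) = 1 / 2 := by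
        field_simp
        norm_num
      rw [h3, ← sub_eq_add_neg] at h2
      have h4 := mul_le_mul_of_nonneg_right h2 (mul_nonneg hB0.le (hv i))
      rw [le_div_iff₀ hB0]
      linarith
    · intro d hd1 hd2 hd3
      refine le_trans ?_ (renewal_jump hv hq hrec hβ0.le hβ hlo i (d / lo) d
        (Nat.div_mul_le_self d lo) (hcover d hd1) hd3)
      exact mul_le_mul_of_nonneg_right
        (pow_le_pow_of_le_one hβ0.le hβ1 (Nat.div_le_div_right hd2)) (hv i)
  have h1 := renewal_max hv hq hrec hq1 hN hXN hfar i hi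
  have hσ0 : 0 ≤ 1 - (X : ℝ) / N := by
    rw [sub_nonneg, div_le_one hN0]
    exact_mod_cast hXN
  have hσ1 : 1 - (X : ℝ) / N ≤ 1 := by
    have : 0 ≤ (X : ℝ) / N := by positivity
    linarith
  have h2 : (1 / 2 : ℝ) ≤ (1 - (X : ℝ) / N) ^ (i + X - N) := by
    refine le_trans ?_ (pow_le_pow_of_le_one hσ0 hσ1 (show i + X - N ≤ X by omega))
    have h3 := one_add_mul_le_pow (a := -((X : ℝ) / N)) (by linarith) X
    rw [← sub_eq_add_neg] at h3
    refine le_trans ?_ h3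
    have h4 : (X : ℝ) * (X / N) ≤ 1 / 2 := by
      rw [← mul_div_assoc, div_le_iff₀ hN0]
      have : (2 : ℝ) * (X : ℝ) ^ 2 ≤ N := by exact_mod_cast hX
      nlinarith
    linarith
  have h3 := mul_le_mul_of_nonneg_right h2 (hv i)
  have h4 : 1 / 2 * v i ≤ 2 * v N / B := h3.trans h1
  rw [le_div_iff₀ hB0] at h4
  linarith

end renewal

/-! ### Concentration of the length of the first cycle -/

section firstCycle

variable {γ : ℝ}

lemma tendsto_log_tiltedSum_atTop (hγ0 : 0 < γ) (hγ1 : γ < 1) :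
    Tendsto (fun s => Real.log (tiltedSum γ s)) (𝓝[>] 0) atTop := by
  have h1 := (tendsto_log_tiltedSum hγ0 hγ1).pos_mul_atTop (consta_pos hγ0 hγ1)
    (tendsto_rpow_neg_nhdsGT_zero (constb_pos hγ0 hγ1))
  refine h1.congr' ?_
  filter_upwards [self_mem_nhdsWithin] with s hs
  have hTT : s ^ constb γ * s ^ (-constb γ) = 1 := by
    rw [← Real.rpow_add hs]; simp
  rw [mul_assoc, hTT, mul_one]

/-- Every large integer is a value of `tiltedSum γ` at a small parameter. -/
lemma eventually_exists_tiltedSum_eq (hγ0 : 0 < γ) (hγ1 : γ < 1) {P : ℝ → Prop}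
    (hP : ∀ᶠ s in 𝓝[>] (0 : ℝ), P s) :
    ∀ᶠ N : ℕ in atTop, ∃ s, 0 < s ∧ s < 1 ∧ P s ∧ tiltedSum γ s = N := by
  obtain ⟨s₀, hs₀, hsub⟩ := mem_nhdsGT_iff_exists_Ioo_subset.1
    (hP.and (Ioo_mem_nhdsGT one_pos))
  have hs₀' : (0 : ℝ) < s₀ := hs₀
  set s₁ := s₀ / 2 with hs₁
  have hs₁0 : 0 < s₁ := by positivity
  have hs₁1 : s₁ < s₀ := by linarith
  filter_upwards [tendsto_natCast_atTop_atTop.eventually (eventually_ge_atTop (tiltedSum γ s₁)),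
    eventually_gt_atTop 0] with N hN hN0
  have hN0' : (0 : ℝ) < N := by exact_mod_cast hN0
  obtain ⟨s₂, hs₂, hs₂1⟩ := (((tendsto_log_tiltedSum_atTop hγ0 hγ1).eventually
    (eventually_ge_atTop (Real.log N))).and (Ioo_mem_nhdsGT hs₁0)).exists
  have h1 : ∀ s, 0 < s → s ≤ s₁ → s < 1 := fun s h0 h1 => (hsub ⟨h0, by linarith⟩).2.2
  have hN2 : (N : ℝ) ≤ tiltedSum γ s₂ :=
    (Real.log_le_log_iff hN0' (tiltedSum_pos hγ0 hγ1 hs₂1.1 (h1 _ hs₂1.1 hs₂1.2.le))).1 hs₂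
  have hcont : ContinuousOn (tiltedSum γ) (Set.Icc s₂ s₁) := by
    intro s hs
    have hs0 : 0 < s := hs₂1.1.trans_le hs.1
    have h2 : ContinuousAt (genFun γ) (1 - s) :=
      (contDiffAt_genFun γ (show 1 - s < 1 by linarith) 0).continuousAt
    have h3 : ContinuousAt (fun s : ℝ => 1 - s) s := by fun_prop
    exact (h3.mul (ContinuousAt.comp (f := fun s : ℝ => 1 - s) h2 h3)).continuousWithinAt
  obtain ⟨s, hs, hsN⟩ := intermediate_value_Icc' hs₂1.2.le hcont ⟨hN, hN2⟩
  have hs0 : 0 < s := hs₂1.1.trans_le hs.1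
  exact ⟨s, hs0, h1 s hs0 hs.2, (hsub ⟨hs0, by linarith [hs.2]⟩).1, hsN⟩

/-- An integer `d ≥ K c` is a sum of `d / lo` integers between `lo` and `hi`, since the slack
`hi - lo`, accumulated over the jumps, exceeds one jump. -/
lemma le_div_mul_of_gap {δ K c : ℝ} {lo hi d : ℕ} (hδ : 0 < δ) (hδ1 : δ ≤ 1) (hc : 2 ≤ c)
    (hδK : δ * K = 8) (hlo0 : 1 ≤ lo) (hlo : (lo : ℝ) < c + 1) (hlo' : (lo : ℝ) ≤ 2 * c)
    (hgap : δ * c / 2 ≤ (hi : ℝ) - lo) (hd : K * c ≤ d) : d ≤ d / lo * hi := by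
  have h2 : d < (d / lo + 1) * lo := by
    rw [mul_comm]
    exact Nat.lt_mul_div_succ d (by omega)
  generalize d / lo = m at h2 ⊢
  have h2' : (d : ℝ) < ((m : ℝ) + 1) * lo := by exact_mod_cast h2
  have hm0 : (0 : ℝ) ≤ m := m.cast_nonneg
  have h4 : ((m : ℝ) + 1) * lo ≤ (m + 1) * (2 * c) :=
    mul_le_mul_of_nonneg_left hlo' (by linarith)
  have h5 : K ≤ ((m : ℝ) + 1) * 2 :=
    le_of_mul_le_mul_right (show K * c ≤ ((m : ℝ) + 1) * 2 * c by linarith) (by linarith)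
  have h6 := mul_le_mul_of_nonneg_left h5 hδ.le
  have h6' : 3 ≤ δ * (m : ℝ) := by linarith
  have h9 := mul_le_mul_of_nonneg_left hgap hm0
  have h10 : 3 * (c / 2) ≤ (δ * (m : ℝ)) * (c / 2) :=
    mul_le_mul_of_nonneg_right h6' (by linarith)
  have h8 : (d : ℝ) ≤ ((m * hi : ℕ) : ℝ) := by
    push_cast
    linarith
  exact_mod_cast h8

lemma natCast_div_mul_le {δ K c : ℝ} {X lo : ℕ} (hδ : 0 < δ) (hδ1 : δ ≤ 1) (hc : 2 ≤ c)
    (hδK : δ * K = 8) (hlo : c ≤ lo) (hX : (X : ℝ) < K * c + 1) :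
    ((2 * X / lo : ℕ) : ℝ) * δ ≤ 17 := by
  have h2 : ((2 * X / lo : ℕ) : ℝ) * lo ≤ 2 * X := by
    exact_mod_cast Nat.div_mul_le_self (2 * X) lo
  generalize 2 * X / lo = m at h2 ⊢
  have h3 := mul_le_mul_of_nonneg_left hlo (m.cast_nonneg : (0 : ℝ) ≤ m)
  have h4 : (m : ℝ) ≤ 2 * K + 1 :=
    le_of_mul_le_mul_right (show (m : ℝ) * c ≤ (2 * K + 1) * c by linarith) (by linarith)
  have h5 := mul_le_mul_of_nonneg_left h4 hδ.le
  linarith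

/-- At the parameter `s` with `∑ⱼ θⱼ (1 - s)ʲ = N`, the tilted sequence `hᵢ (1 - s)ⁱ` exceeds its
value at `N` by at most an arbitrarily small power of `N`, for all `i ≤ N`. -/
lemma eventually_h_comparison (hγ0 : 0 < γ) (hγ1 : γ < 1) {δ : ℝ} (hδ : 0 < δ) (hδ1 : δ ≤ 1)
    (hδK : 2 ^ (constb γ + 1) / constb γ < 8 / δ) :
    ∀ᶠ s in 𝓝[>] (0 : ℝ), ∀ N : ℕ, tiltedSum γ s = N → ∀ i ≤ N,
      h (theta γ) i * (1 - s) ^ i ≤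
        4 * Real.exp (102 * δ * s ^ (-constb γ)) * (h (theta γ) N * (1 - s) ^ N) := by
  have ha := consta_pos hγ0 hγ1
  have hb := constb_pos hγ0 hγ1
  -- A jump has length between `c` and `(1 + δ) c`, where `c` is the centre, and probability at least
  -- `exp (-6 δ² T)`, where `T = s ^ (-b)`. From the distance `K c` on, every integer is a sum of such
  -- jumps; distances up to `2 K c + 2` need at most `17 / δ` of them.
  set K := 8 / δ with hK
  have hK8 : 8 ≤ K := by
    rw [hK, le_div_iff₀ hδ]
    linarith
  have hδK' : δ * K = 8 := by rw [hK]; field_simp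
  have hlog := tendsto_log_tiltedSum hγ0 hγ1
  -- `N` grows exponentially in `T`, but `c` only polynomially, so that eventually `8 (K c)² ≤ N`
  have h1 := (hlog.sub ((tendsto_rpow_nhdsGT_zero hb).const_mul (Real.log (8 * K ^ 2)))).sub
    ((tendsto_log_centre hγ0 hγ1).const_mul 2)
  rw [mul_zero, sub_zero, mul_zero, sub_zero] at h1
  filter_upwards [eventually_le_term hγ0 hγ1 hδ hδ1, eventually_far_tail_le hγ0 hγ1 hδK,
    hlog.eventually (gt_mem_nhds (show consta γ < consta γ + δ ^ 2 by
      have : 0 < δ ^ 2 := by positivity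
      linarith)),
    h1.eventually (lt_mem_nhds ha),
    (tendsto_centre hγ0 hγ1).eventually (eventually_ge_atTop (4 / δ)),
    Ioo_mem_nhdsGT one_pos] with s eterm efar elog eX ec hs N hN
  have hs0 : 0 < s := hs.1
  have hs1 : s < 1 := hs.2
  have hp1 : 0 < 1 - s := by linarith
  set c := centre γ s with hc
  have hc0 : 0 < c := centre_pos hγ0 hγ1 hs0
  have hδc : 4 ≤ δ * c := by
    rw [div_le_iff₀ hδ] at ec
    linarith
  have hc4 : 4 ≤ c := by nlinarith
  set T := s ^ (-constb γ) with hTdef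
  have hT : 0 < T := Real.rpow_pos_of_pos hs0 _
  have hTT : s ^ constb γ * T = 1 := by
    rw [hTdef, ← Real.rpow_add hs0]; simp
  have hΛ := tiltedSum_pos hγ0 hγ1 hs0 hs1
  have hN0 : (0 : ℝ) < N := hN ▸ hΛ
  set q : ℕ → ℝ := fun j => theta γ j * (1 - s) ^ j / N with hq
  set v : ℕ → ℝ := fun i => h (theta γ) i * (1 - s) ^ i with hv
  have hhpos := h_pos (θ := theta γ) fun j hj => theta_pos hγ0 hγ1 hj
  have hv0 : ∀ i, 0 ≤ v i := fun i => (mul_pos (hhpos i) (pow_pos hp1 i)).le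
  have hq0 : ∀ j, 1 ≤ j → 0 ≤ q j := fun j hj =>
    (div_pos (mul_pos (theta_pos hγ0 hγ1 hj) (pow_pos hp1 j)) hN0).le
  have hqsum : ∀ k, ∑ j ∈ Finset.Icc 1 k, q j =
      (∑ j ∈ Finset.Icc 1 k, theta γ j * (1 - s) ^ j) / N := fun k => by
    rw [Finset.sum_div]
  have hrec : ∀ k : ℕ, (k : ℝ) * v k = N * ∑ j ∈ Finset.Icc 1 k, q j * v (k - j) := by
    intro k
    rw [hv]
    simp only
    rw [← mul_assoc, h_recurrence, Finset.sum_mul, Finset.mul_sum]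
    refine Finset.sum_congr rfl fun j hj => ?_
    have hjk := (Finset.mem_Icc.1 hj).2
    have hpow : (1 - s) ^ k = (1 - s) ^ j * (1 - s) ^ (k - j) := by
      rw [← pow_add, Nat.add_sub_cancel' hjk]
    rw [hpow, hq]
    field_simp
  have hq1 : ∀ k, ∑ j ∈ Finset.Icc 1 k, q j ≤ 1 := by
    intro k
    rw [hqsum, div_le_one hN0, ← hN]
    exact sum_le_tiltedSum hγ0 hγ1 hs0 hs1 fun j hj => (Finset.mem_Icc.1 hj).1
  set X := ⌈K * c⌉₊ with hXdef
  set lo := ⌈c⌉₊ with hlodef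
  set hi := ⌊(1 + δ) * c⌋₊ with hhidef
  have hX1 : K * c ≤ X := Nat.le_ceil _
  have hX2 : (X : ℝ) < K * c + 1 := Nat.ceil_lt_add_one (by positivity)
  have hlo1 : c ≤ lo := Nat.le_ceil _
  have hlo2 : (lo : ℝ) < c + 1 := Nat.ceil_lt_add_one hc0.le
  have hhi1 : (hi : ℝ) ≤ (1 + δ) * c := Nat.floor_le (by positivity)
  have hhi2 : (1 + δ) * c < hi + 1 := Nat.lt_floor_add_one _
  have hlo0 : 1 ≤ lo := by
    have : (0 : ℝ) < lo := hc0.trans_le hlo1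
    exact_mod_cast this
  have hKc : 32 ≤ K * c := by nlinarith
  have hXpos : 1 ≤ X := by
    have : (0 : ℝ) < X := by linarith
    exact_mod_cast this
  -- the tail of `q` beyond `X`
  have hqX : 1 - 1 / (2 * (N : ℝ)) ≤ ∑ j ∈ Finset.Icc 1 X, q j := by
    rw [hqsum, le_div_iff₀ hN0]
    have h2 : (1 - 1 / (2 * (N : ℝ))) * N = N - 1 / 2 := by
      field_simp
    rw [h2, ← hN, sub_le_iff_le_add]
    refine tiltedSum_le hγ0 hγ1 hs0 hs1 fun F hF => ?_
    rw [← Finset.sum_filter_add_sum_filter_not F (fun j => j ≤ X)]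
    refine add_le_add ?_ (efar _ fun j hj => ?_)
    · refine Finset.sum_le_sum_of_subset_of_nonneg ?_ fun j hj _ => ?_
      · intro j hj
        rw [Finset.mem_filter] at hj
        exact Finset.mem_Icc.2 ⟨hF j hj.1, hj.2⟩
      · have := theta_pos hγ0 hγ1 (Finset.mem_Icc.1 hj).1
        positivity
    · rw [Finset.mem_filter, not_le] at hj
      refine ⟨hF j hj.1, ?_⟩
      have : (X : ℝ) ≤ j := by exact_mod_cast hj.2.le
      linarith
  -- the mass of `q` near the centre
  have hβ : ∀ j, lo ≤ j → j ≤ hi → Real.exp (-(6 * δ ^ 2 * T)) ≤ q j := by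
    intro j hj1 hj2
    have h2 : (lo : ℝ) ≤ j := by exact_mod_cast hj1
    have h3 : (j : ℝ) ≤ hi := by exact_mod_cast hj2
    have h4 := eterm j (by linarith) (by linarith)
    rw [hq]
    simp only
    rw [le_div_iff₀ hN0]
    refine le_trans ?_ h4
    have h5 := mul_lt_mul_of_pos_right elog hT
    rw [mul_assoc, hTT, mul_one] at h5
    rw [← hN, ← Real.exp_log hΛ, ← Real.exp_add]
    refine Real.exp_le_exp.2 ?_
    linarith
  have hlo3 : (lo : ℝ) ≤ 2 * c := by linarith
  have hgap : δ * c / 2 ≤ (hi : ℝ) - lo := by linarith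
  have hcover : ∀ d, X ≤ d → d ≤ d / lo * hi := fun d hd =>
    le_div_mul_of_gap hδ hδ1 (by linarith) hδK' hlo0 hlo2 hlo3 hgap
      (hX1.trans (by exact_mod_cast hd))
  have hXN : 2 * X ^ 2 ≤ N := by
    have h2 := mul_pos eX hT
    have h3 : (Real.log (tiltedSum γ s) * s ^ constb γ - Real.log (8 * K ^ 2) * s ^ constb γ -
        2 * (Real.log c * s ^ constb γ)) * T =
        Real.log (tiltedSum γ s) - Real.log (8 * K ^ 2) - 2 * Real.log c := by
      linear_combination (Real.log (tiltedSum γ s) - Real.log (8 * K ^ 2) - 2 * Real.log c) * hTT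
    rw [h3] at h2
    have h4 : Real.log (8 * K ^ 2 * c ^ 2) ≤ Real.log (tiltedSum γ s) := by
      rw [Real.log_mul (by positivity) (by positivity), Real.log_pow c]
      push_cast
      linarith
    have h5 := (Real.log_le_log_iff (by positivity) hΛ).1 h4
    rw [hN] at h5
    have h6 : (X : ℝ) ≤ 2 * (K * c) := by linarith
    have h7 : (X : ℝ) ^ 2 ≤ (2 * (K * c)) ^ 2 := pow_le_pow_left₀ (by positivity) h6 2
    have h8 : (2 : ℝ) * (X : ℝ) ^ 2 ≤ N := by linarith
    exact_mod_cast h8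
  have hβ1 : Real.exp (-(6 * δ ^ 2 * T)) ≤ 1 := Real.exp_le_one_iff.2 (by
    have : 0 ≤ 6 * δ ^ 2 * T := by positivity
    linarith)
  intro i hiN
  have hmain := renewal_comparison hv0 hq0 hrec hq1 hqX (Real.exp_pos _) hβ1 hβ hlo0 hcover hXN
    hXpos hiN
  rw [← Real.exp_nat_mul] at hmain
  have hm : ((2 * X / lo : ℕ) : ℝ) * δ ≤ 17 :=
    natCast_div_mul_le hδ hδ1 (by linarith) hδK' hlo1 hX2
  have hexp : Real.exp (-(102 * δ * T)) ≤
      Real.exp (((2 * X / lo : ℕ) : ℝ) * -(6 * δ ^ 2 * T)) := by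
    refine Real.exp_le_exp.2 ?_
    have h2 := mul_le_mul_of_nonneg_right hm (show 0 ≤ 6 * δ * T by positivity)
    linarith
  have h2 := mul_le_mul_of_nonneg_right hexp (hv0 i)
  have h3 : Real.exp (-(102 * δ * T)) * v i ≤ 4 * v N := h2.trans hmain
  rw [Real.exp_neg, inv_mul_le_iff₀ (Real.exp_pos _)] at h3
  change v i ≤ 4 * Real.exp (102 * δ * T) * v N
  linarith

/-- Under `law θ N` the first cycle has length close to the centre for the parameter `s` with
`∑ⱼ θⱼ (1 - s)ʲ = N`. -/
lemma eventually_sum_far_le (hγ0 : 0 < γ) (hγ1 : γ < 1) {ε ρ : ℝ} (hε : 0 < ε) (hρ : 0 < ρ) :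
    ∀ᶠ s in 𝓝[>] (0 : ℝ), ∀ N : ℕ, tiltedSum γ s = N → ∀ F ⊆ Finset.Icc 1 N,
      (∀ j ∈ F, (j : ℝ) ≤ (1 - ε) * centre γ s ∨ (1 + ε) * centre γ s ≤ j) →
      ∑ j ∈ F, theta γ j * h (theta γ) (N - j) / (N * h (theta γ) N) ≤ ρ := by
  have hb := constb_pos hγ0 hγ1
  obtain ⟨η, hη, htail⟩ := exists_tail_bound hγ0 hγ1 hε
  -- `δ` is small enough for the loss in `eventually_h_comparison` to be beaten by the tail bound
  obtain ⟨δ, hδ0, hδ1⟩ : ∃ δ : ℝ, 0 < δ ∧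
      δ < min (min 1 (8 / (2 ^ (constb γ + 1) / constb γ))) (η / 408) :=
    exists_between (by positivity)
  rw [lt_min_iff, lt_min_iff] at hδ1
  obtain ⟨⟨hδ1, hδ2⟩, hδ3⟩ := hδ1
  have hδK : 2 ^ (constb γ + 1) / constb γ < 8 / δ := by
    rw [lt_div_comm₀ hδ0 (by positivity)] at hδ2
    exact hδ2
  have h1 : Tendsto (fun s : ℝ => 8 * Real.exp (-(η / 4) * s ^ (-constb γ))) (𝓝[>] 0)
      (𝓝 (8 * 0)) :=
    (Real.tendsto_exp_atBot.comp ((tendsto_rpow_neg_nhdsGT_zero hb).const_mul_atTop_of_neg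
      (by linarith))).const_mul 8
  rw [mul_zero] at h1
  filter_upwards [htail, eventually_h_comparison hγ0 hγ1 hδ0 hδ1.le hδK,
    h1.eventually (gt_mem_nhds hρ),
    (tendsto_log_tiltedSum hγ0 hγ1).eventually
      (lt_mem_nhds (show consta γ - η / 2 < consta γ by linarith)),
    Ioo_mem_nhdsGT one_pos] with s htail hcomp e1 elog hs N hN F hF hFfar
  have hs0 : 0 < s := hs.1
  have hp1 : 0 < 1 - s := by linarith [hs.2]
  set T := s ^ (-constb γ) with hTdef
  have hT : 0 < T := Real.rpow_pos_of_pos hs0 _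
  have hTT : s ^ constb γ * T = 1 := by
    rw [hTdef, ← Real.rpow_add hs0]; simp
  have hΛ := tiltedSum_pos hγ0 hγ1 hs0 hs.2
  have hN0 : (0 : ℝ) < N := hN ▸ hΛ
  have hhN := h_pos (θ := theta γ) (fun j hj => theta_pos hγ0 hγ1 hj) N
  have hterm : ∀ j ∈ F, theta γ j * h (theta γ) (N - j) / (N * h (theta γ) N) ≤
      theta γ j * (1 - s) ^ j * (4 * Real.exp (102 * δ * T) / N) := by
    intro j hj
    obtain ⟨hj1, hjN⟩ := Finset.mem_Icc.1 (hF hj)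
    have h2 := hcomp N hN (N - j) (Nat.sub_le N j)
    have hpow : (1 - s) ^ N = (1 - s) ^ (N - j) * (1 - s) ^ j := by
      rw [← pow_add, Nat.sub_add_cancel hjN]
    rw [hpow] at h2
    have hpj : 0 < (1 - s) ^ (N - j) := pow_pos hp1 _
    have h3 : h (theta γ) (N - j) ≤
        4 * Real.exp (102 * δ * T) * (h (theta γ) N * (1 - s) ^ j) := by
      refine le_of_mul_le_mul_right ?_ hpj
      linarith
    have h4 := mul_le_mul_of_nonneg_left h3 (theta_pos hγ0 hγ1 hj1).le
    rw [div_le_iff₀ (mul_pos hN0 hhN)]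
    refine h4.trans (le_of_eq ?_)
    field_simp
  refine (Finset.sum_le_sum hterm).trans ?_
  rw [← Finset.sum_mul]
  have h2 := htail F fun j hj => ⟨(Finset.mem_Icc.1 (hF hj)).1, hFfar j hj⟩
  refine (mul_le_mul_of_nonneg_right h2 (by positivity)).trans (le_trans ?_ e1.le)
  have h3 := mul_lt_mul_of_pos_right elog hT
  rw [mul_assoc, hTT, mul_one] at h3
  have h4 := Real.exp_le_exp.2 h3.le
  rw [Real.exp_log hΛ, hN] at h4
  rw [mul_div_assoc', div_le_iff₀ hN0]
  refine le_trans ?_ (mul_le_mul_of_nonneg_left h4 (by positivity))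
  have h5 : 2 * Real.exp ((consta γ - η) * T) * (4 * Real.exp (102 * δ * T)) =
      8 * Real.exp ((consta γ - η) * T + 102 * δ * T) := by
    rw [Real.exp_add]; ring
  have h7 : 8 * Real.exp (-(η / 4) * T) * Real.exp ((consta γ - η / 2) * T) =
      8 * Real.exp (-(η / 4) * T + (consta γ - η / 2) * T) := by
    rw [Real.exp_add]; ring
  rw [h5, h7]
  refine mul_le_mul_of_nonneg_left (Real.exp_le_exp.2 ?_) (by norm_num)
  have h6 := mul_lt_mul_of_pos_right hδ3 hT
  linarith

/-- The centre is asymptotic to `((1 - γ)⁻¹ log N) ^ (1 / γ)`. -/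
lemma tendsto_centre_div (hγ0 : 0 < γ) (hγ1 : γ < 1) :
    Tendsto (fun s => centre γ s / Real.log (tiltedSum γ s) ^ (1 / γ)) (𝓝[>] 0)
      (𝓝 ((1 - γ) ^ (-1 / γ))) := by
  have ha := consta_pos hγ0 hγ1
  have hb := constb_pos hγ0 hγ1
  have hw : 0 < γ ^ constb γ := Real.rpow_pos_of_pos hγ0 _
  have h1γ : 0 < 1 - γ := by linarith
  have h1 : Tendsto (fun s => (γ ^ constb γ / (Real.log (tiltedSum γ s) * s ^ constb γ)) ^ (1 / γ))
      (𝓝[>] 0) (𝓝 ((γ ^ constb γ / consta γ) ^ (1 / γ))) :=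
    (tendsto_const_nhds.div (tendsto_log_tiltedSum hγ0 hγ1) ha.ne').rpow_const
      (Or.inr (by positivity))
  have h2 : (γ ^ constb γ / consta γ) ^ (1 / γ) = (1 - γ) ^ (-1 / γ) := by
    have h3 : γ ^ constb γ / consta γ = (1 - γ)⁻¹ := by
      have : consta γ = (1 - γ) * γ ^ constb γ := rfl
      rw [this]
      field_simp
    rw [h3, Real.inv_rpow h1γ.le, ← Real.rpow_neg h1γ.le]
    congr 1
    ring
  rw [h2] at h1
  refine h1.congr' ?_
  filter_upwards [self_mem_nhdsWithin,
    (tendsto_log_tiltedSum_atTop hγ0 hγ1).eventually (eventually_gt_atTop 0)] with s hs hl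
  have hs0 : (0 : ℝ) < s := hs
  have hc := centre_pos hγ0 hγ1 hs0
  have h3 : γ ^ constb γ / (Real.log (tiltedSum γ s) * s ^ constb γ) =
      centre γ s ^ γ / Real.log (tiltedSum γ s) := by
    rw [centre_rpow hγ0 hγ1 hs0, Real.rpow_neg hs0.le]
    have := Real.rpow_pos_of_pos hs0 (constb γ)
    field_simp
  rw [h3, Real.div_rpow (Real.rpow_pos_of_pos hc _).le hl.le, ← Real.rpow_mul hc.le,
    mul_one_div_cancel hγ0.ne', Real.rpow_one]

/-- The first cycle has length `((1 - γ)⁻¹ log n) ^ (1 / γ)` up to a factor tending to `1` in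
probability. -/
lemma tendsto_law_firstCycleLength (hγ0 : 0 < γ) (hγ1 : γ < 1) {ε : ℝ} (hε : 0 < ε) :
    Tendsto (fun n : ℕ => law (theta γ) n
      {σ | ε < |(firstCycleLength σ : ℝ) / Real.log n ^ (1 / γ) - (1 - γ) ^ (-1 / γ)|})
      atTop (𝓝 0) := by
  classical
  set r₀ := (1 - γ) ^ (-1 / γ) with hr₀
  have hr₀pos : 0 < r₀ := Real.rpow_pos_of_pos (by linarith) _
  set ε' := ε / (2 * (r₀ + 1)) with hε'
  have hε'pos : 0 < ε' := by positivity
  have hε'' : ε' * (r₀ + 1) = ε / 2 := by rw [hε']; field_simp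
  rw [ENNReal.tendsto_nhds_zero]
  intro ρ hρ
  obtain ⟨ρ', hρ'0, hρ'⟩ := ENNReal.lt_iff_exists_nnreal_btwn.1 hρ
  have hρ'1 : (0 : ℝ) < ρ' := by exact_mod_cast hρ'0
  have hlim := tendsto_centre_div hγ0 hγ1
  have hP := ((eventually_sum_far_le hγ0 hγ1 hε'pos hρ'1).and
    (hlim.eventually (Metric.ball_mem_nhds r₀ (show 0 < min 1 (ε / 2) by positivity)))).and
    ((tendsto_log_tiltedSum_atTop hγ0 hγ1).eventually (eventually_gt_atTop 0))
  filter_upwards [eventually_exists_tiltedSum_eq hγ0 hγ1 hP, eventually_gt_atTop 0]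
    with N ⟨s, hs0, hs1, ⟨⟨hfar, hball⟩, hlogpos⟩, hN⟩ hN0
  rw [law_firstCycleLength (fun j hj => theta_pos hγ0 hγ1 hj) hN0
    (fun l => ε < |(l : ℝ) / Real.log N ^ (1 / γ) - r₀|)]
  refine le_trans (ENNReal.ofReal_le_ofReal
    (hfar N hN _ (Finset.filter_subset _ _) fun j hj => ?_)) ?_
  · by_contra! hcon
    have hj' := (Finset.mem_filter.1 hj).2
    rw [hN] at hball hlogpos
    set Lg := Real.log N ^ (1 / γ) with hLg
    have hL : 0 < Lg := Real.rpow_pos_of_pos hlogpos _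
    have hc := centre_pos hγ0 hγ1 hs0
    rw [Real.dist_eq, lt_min_iff] at hball
    have h1 : |(j : ℝ) / Lg - centre γ s / Lg| ≤ ε' * (centre γ s / Lg) := by
      rw [← sub_div, abs_div, abs_of_pos hL, mul_div_assoc']
      refine div_le_div_of_nonneg_right ?_ hL.le
      rw [abs_le]
      constructor <;> linarith [hcon.1, hcon.2]
    have h2 : centre γ s / Lg ≤ r₀ + 1 := by linarith [(abs_lt.1 hball.1).2]
    have h3 := mul_le_mul_of_nonneg_left h2 hε'pos.le
    have h4 := abs_sub_le ((j : ℝ) / Lg) (centre γ s / Lg) r₀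
    linarith [hball.2]
  · rw [ENNReal.ofReal_coe_nnreal]
    exact hρ'.le

end firstCycle

/-- Convergence in probability to a constant implies convergence in distribution, also when the
variables live on different probability spaces. -/
lemma tendstoInDistribution_of_tendsto_measure {Ω : ℕ → Type*} [∀ n, MeasurableSpace (Ω n)]
    {μ : ∀ n, Measure (Ω n)} [∀ n, IsProbabilityMeasure (μ n)] {X : ∀ n, Ω n → ℝ}
    (hX : ∀ n, Measurable (X n)) {x : ℝ}
    (h : ∀ ε : ℝ, 0 < ε → Tendsto (fun n => μ n {ω | ε < |X n ω - x|}) atTop (𝓝 0)) :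
    TendstoInDistribution X atTop (id : ℝ → ℝ) μ (Measure.dirac x) := by
  refine ⟨fun n => (hX n).aemeasurable, aemeasurable_id, ?_⟩
  refine tendsto_of_forall_isOpen_le_liminf' fun G hG => ?_
  change (Measure.dirac x).map id G ≤ liminf (fun n => (μ n).map (X n) G) atTop
  rw [Measure.map_id, Measure.dirac_apply' x hG.measurableSet]
  by_cases hxG : x ∈ G
  · obtain ⟨ε, hε, hsub⟩ := Metric.isOpen_iff.1 hG x hxG
    rw [Set.indicator_of_mem hxG]
    have h1 : Tendsto (fun n => 1 - μ n {ω | ε / 2 < |X n ω - x|}) atTop (𝓝 (1 - 0)) :=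
      ENNReal.Tendsto.sub tendsto_const_nhds (h (ε / 2) (by positivity))
        (Or.inl ENNReal.one_ne_top)
    rw [tsub_zero] at h1
    rw [Pi.one_apply, ← h1.liminf_eq]
    refine liminf_le_liminf (Eventually.of_forall fun n => ?_)
    change 1 - μ n {ω | ε / 2 < |X n ω - x|} ≤ (μ n).map (X n) G
    rw [Measure.map_apply (hX n) hG.measurableSet, tsub_le_iff_right,
      ← measure_univ (μ := μ n)]
    refine (measure_mono fun ω _ => ?_).trans (measure_union_le _ _)
    by_cases hω : ε / 2 < |X n ω - x|
    · exact Or.inr hω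
    · refine Or.inl (hsub ?_)
      rw [Metric.mem_ball, Real.dist_eq]
      linarith
  · rw [Set.indicator_of_notMem hxG]
    exact zero_le

end WeightedPerm

/-- Subexponentially growing cycle weights: `θ_j` are positive, so the laws `P_n` are probability
measures; `L_1 / (log n) ^ (1/γ)` converges in probability, and in distribution, to the constant
`(1 - γ) ^ (-1/γ)`; the sequence `(R_1, R_2, …)` converges weakly, in the product space `ℕ → ℕ`, to
independent Poisson variables of means `θ_j / j`. -/
theorem mainTheorem3 (γ : ℝ) (hγ0 : 0 < γ) (hγ1 : γ < 1) :
    (∀ j : ℕ, 1 ≤ j → 0 < WeightedPerm.theta γ j) ∧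
    ∃ _ : ∀ n : ℕ, IsProbabilityMeasure (WeightedPerm.law (WeightedPerm.theta γ) n),
      (∀ ε : ℝ, 0 < ε →
        Tendsto
          (fun n : ℕ => WeightedPerm.law (WeightedPerm.theta γ) n
            {σ | ε < |(WeightedPerm.firstCycleLength σ : ℝ) / Real.log n ^ (1 / γ)
                    - (1 - γ) ^ (-1 / γ)|})
          atTop (𝓝 0)) ∧
      TendstoInDistribution
        (fun (n : ℕ) (σ : Equiv.Perm (Fin n)) =>
          (WeightedPerm.firstCycleLength σ : ℝ) / Real.log n ^ (1 / γ))
        atTop (id : ℝ → ℝ)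
        (fun n : ℕ => WeightedPerm.law (WeightedPerm.theta γ) n)
        (Measure.dirac ((1 - γ) ^ (-1 / γ))) ∧
      TendstoInDistribution
        (fun (n : ℕ) (σ : Equiv.Perm (Fin n)) (i : ℕ) => WeightedPerm.cycleCount σ (i + 1))
        atTop (id : (ℕ → ℕ) → (ℕ → ℕ))
        (fun n : ℕ => WeightedPerm.law (WeightedPerm.theta γ) n)
        (Measure.infinitePi fun i : ℕ =>
          poissonMeasure (Real.toNNReal (WeightedPerm.theta γ (i + 1) / (i + 1 : ℝ)))) := by
  have hθ : ∀ j : ℕ, 1 ≤ j → 0 < WeightedPerm.theta γ j := fun j hj =>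
    WeightedPerm.theta_pos hγ0 hγ1 hj
  have hlaw := WeightedPerm.isProbabilityMeasure_law hθ
  have hfirst := fun (ε : ℝ) (hε : 0 < ε) =>
    WeightedPerm.tendsto_law_firstCycleLength hγ0 hγ1 hε
  exact ⟨hθ, hlaw, hfirst,
    WeightedPerm.tendstoInDistribution_of_tendsto_measure (fun _ => measurable_from_top) hfirst,
    WeightedPerm.tendstoInDistribution_cycleCount hθ (WeightedPerm.tendsto_h_ratio hγ0 hγ1)⟩
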